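/- Let $\Omega\subset\mathbb R^{n_0}$ be a bounded open set, $r>0$, $d\ge 0$, $C:=C([-r,0];L^2(\Omega))$ with the maximum norm $\|\cdot\|_C$, and let $A$ be a densely defined, self-adjoint, positive ($\langle Av,v\rangle\ge 0$) linear operator in $L^2(\Omega)$ with compact resolvent. Let $b:\mathbb R\to\mathbb R$ be Lipschitz and bounded and let $f:\Omega-\Omega\to\mathbb R$ be measurable and bounded. Let $g:[-r,0]\times C\to\mathbb R$ be split as $g=g_d+g_{ac}+g_s$, where, for every $\varphi\in C$, $g_d(\cdot,\varphi)$ is a step (jump) function, $g_{ac}(\cdot,\varphi)$ is absolutely continuous and $g_s(\cdot,\varphi)$ is singular continuous, and put $g_c=g_{ac}+g_s$. Write $V[\cdot]$ for the total variation on $[-r,0]$. Assume: (A1) there is $M>0$ such that $V[g(\cdot,\varphi)]\le M$ for all $\varphi\in C$; (A2) for every $\theta\in[-r,0]$ the functions $g_{ac}(\theta,\cdot)$ and $g_s(\theta,\cdot)$ are continuous on $C$; (A3) there are (finitely or countably many) continuous functions $\eta_k:C\to[0,r]$ and $h_k:C\to\mathbb R$ such that, for every $\varphi\in C$, the jumps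 of $g_d(\cdot,\varphi)$ are located at the points $\theta_k=-\eta_k(\varphi)$, with $h_k(\varphi)=g_d(\theta_k+0,\varphi)-g_d(\theta_k-0,\varphi)$ (where several of the points $\theta_k$ coincide, the jump is the sum of the corresponding $h_k(\varphi)$; at the end points, $g_d(0+0,\varphi):=g_d(0,\varphi)$ and $g_d(-r-0,\varphi):=g_d(-r,\varphi)$), and the series $\sum_k|h_k(\varphi)|$ converges, uniformly on bounded subsets of $C$; (A4) there is $L\ge 0$ such that $V[g_c(\cdot,\varphi)-g_c(\cdot,\psi)]\le L\|\varphi-\psi\|_C$ for all $\varphi,\psi\in C$; (A5) (uniform ignoring condition) there is $\eta_{ign}>0$ such that, for all $\varphi^1,\varphi^2\in C$ which coincide on $[-r,0]\cap(-\infty,-\eta_{ign}]$, one has $\eta_k(\varphi^1)=\eta_k(\varphi^2)$ and $h_k(\varphi^1)=h_k(\varphi^2)$ for all $k$. Let $F:C\to L^2(\Omega)$ be given by the Stieltjes integral $$F(\varphi)(x)=\int_{-r}^0\Big\{\int_\Omega b(\varphi(\theta,y))\,f(x-y)\,dy\Big\}\,dg(\theta,\varphi),\qquad x\in\Omega .$$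 For $T>0$ and $\varphi\in C$, a mild solution on $[-r,T]$ is a function $u\in C([-r,T];L^2(\Omega))$ with $u|_{[-r,0]}=\varphi$ and $$u(t)=e^{-At}\varphi(0)+\int_0^t e^{-A(t-s)}\{F(u_s)-d\,u(s)\}\,ds,\qquad t\in[0,T],$$ where $u_t(\theta)=u(t+\theta)$ for $\theta\in[-r,0]$. Then $F$ indeed maps $C$ into $L^2(\Omega)$, and for every $\varphi\in C$ there is a unique mild solution on $[-r,T]$ for every $T>0$, and a unique $u\in C([-r,\infty);L^2(\Omega))$ whose restriction to $[-r,T]$ is a mild solution for every $T>0$. The solution depends continuously on the initial data: if $\|\varphi^n-\varphi\|_C\to 0$ and $u^n,u$ are the mild solutions with initial data $\varphi^n,\varphi$, then $\|u^n_t-u_t\|_C\to 0$ for every $t\ge 0$. -/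

import Mathlib

open Set Filter Topology MeasureTheory
open scoped Pointwise NNReal ENNReal

noncomputable section

namespace DelayPDE

/-! ### Unbounded operators and the semigroup `e^{-tA}` -/

section Operators

variable {H : Type*} [NormedAddCommGroup H] [InnerProductSpace ℝ H]

/-- `A` is positive: `⟨A v, v⟩ ≥ 0` on the domain. -/
def IsPositive (A : H →ₗ.[ℝ] H) : Prop :=
  ∀ v : A.domain, 0 ≤ inner ℝ (A v) (v : H)

/-- `R` is the bounded (everywhere defined) inverse of `A - μ`. -/
def IsResolventAt (A : H →ₗ.[ℝ] H) (μ : ℝ) (R : H →L[ℝ] H) : Prop :=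
  (∀ v : H, ∃ h : R v ∈ A.domain, A ⟨R v, h⟩ - μ • R v = v) ∧
    ∀ v : A.domain, R (A v - μ • (v : H)) = v

/-- `A` has compact resolvent: `(A - μ)⁻¹` exists and is compact for some `μ`. -/
def HasCompactResolvent (A : H →ₗ.[ℝ] H) : Prop :=
  ∃ (μ : ℝ) (R : H →L[ℝ] H), IsResolventAt A μ R ∧ IsCompactOperator R

/-- The eigenspace `ker (A - c)` of an unbounded operator. -/
def eigenspace (A : H →ₗ.[ℝ] H) (c : ℝ) : Submodule ℝ H where
  carrier := {v | ∃ h : v ∈ A.domain, A ⟨v, h⟩ = c • v}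
  add_mem' := by
    rintro v w ⟨hv, hv'⟩ ⟨hw, hw'⟩
    refine ⟨A.domain.add_mem hv hw, ?_⟩
    have := A.map_add ⟨v, hv⟩ ⟨w, hw⟩
    rw [hv', hw', ← smul_add] at this
    exact this
  zero_mem' := ⟨A.domain.zero_mem, by
    have := A.map_zero
    rw [smul_zero]; exact this⟩
  smul_mem' := by
    rintro a v ⟨hv, hv'⟩
    refine ⟨A.domain.smul_mem a hv, ?_⟩
    have := A.map_smul a ⟨v, hv⟩
    rw [hv', smul_comm] at this
    exact this

/-- The operator `e^{-tA}` (for `t ≥ 0`) of a self-adjoint, positive operator `A` with compact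
resolvent, through the spectral resolution of `A`: if `P_c` is the orthogonal projection onto
`ker (A - c)`, then `e^{-tA} v = ∑_c e^{-tc} P_c v`, the sum being over all real `c` (only the
countably many eigenvalues contribute). The eigenspaces are closed, so that taking the closure
changes nothing; it only provides the orthogonal projection. -/
def expNeg [CompleteSpace H] (A : H →ₗ.[ℝ] H) (t : ℝ) (v : H) : H :=
  ∑' c : ℝ, Real.exp (-(t * c)) • (eigenspace A c).topologicalClosure.starProjection v

end Operators

/-! ### Functions of bounded variation on `[-r, 0]` -/

section BoundedVariation

instance compactIccSpace_Icc (a b : ℝ) : CompactIccSpace (Icc a b) :=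
  ⟨fun {_ _} => isClosed_Icc.isCompact⟩

/-- The Lebesgue–Stieltjes (signed) measure on `[-r, 0]` of a function of bounded variation. The
mass of `{θ}` is the jump at `θ`, where `G(0+) = G(0)` and `G(-r-0) = G(-r)`. -/
def stieltjesMeasure {r : ℝ} (G : Icc (-r) 0 → ℝ) : VectorMeasure (Icc (-r) 0) ℝ :=
  open Classical in
  if h : BoundedVariationOn G univ then h.vectorMeasure else 0

/-- The Stieltjes integral `∫_{-r}^0 χ(θ) dG(θ)`. -/
def stieltjesIntegral {r : ℝ} (χ G : Icc (-r) 0 → ℝ) : ℝ :=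
  (stieltjesMeasure G).integral χ (ContinuousLinearMap.lsmul ℝ ℝ)

/-- The jump `G(θ+0) - G(θ-0)`, with `G(0+) = G(0)` and `G(-r-0) = G(-r)`. -/
def jump {r : ℝ} (G : Icc (-r) 0 → ℝ) (θ : Icc (-r) 0) : ℝ :=
  Function.rightLim G θ - Function.leftLim G θ

/-- `G` is a step function (jump function, possibly with infinitely many jumps):
`G(θ) = c + ∑_{xₙ < θ} aₙ + ∑_{xₙ ≤ θ} a'ₙ` with absolutely convergent series. -/
def IsStepFunction {r : ℝ} (G : Icc (-r) 0 → ℝ) : Prop :=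
  ∃ (c : ℝ) (x : ℕ → Icc (-r) 0) (a a' : ℕ → ℝ),
    Summable (fun n => |a n|) ∧ Summable (fun n => |a' n|) ∧
    ∀ θ, G θ = c + (∑' n, if x n < θ then a n else 0) + ∑' n, if x n ≤ θ then a' n else 0

/-- `G` is absolutely continuous on `[-r, 0]`. -/
def IsAbsolutelyContinuous {r : ℝ} (hr : 0 < r) (G : Icc (-r) 0 → ℝ) : Prop :=
  AbsolutelyContinuousOnInterval (IccExtend (neg_nonpos.2 hr.le) G) (-r) 0

/-- `G` is singular continuous on `[-r, 0]`: continuous, of bounded variation, with `G' = 0`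
almost everywhere. -/
def IsSingularContinuous {r : ℝ} (hr : 0 < r) (G : Icc (-r) 0 → ℝ) : Prop :=
  Continuous G ∧ BoundedVariationOn G univ ∧
    ∀ᵐ θ ∂(volume.restrict (Ioo (-r) 0)),
      HasDerivAt (IccExtend (neg_nonpos.2 hr.le) G) 0 θ

end BoundedVariation

/-! ### The delay and its assumptions -/

/-- `L²(Ω)`, real-valued. -/
abbrev L2 {n : ℕ} (Ω : Set (EuclideanSpace ℝ (Fin n))) : Type :=
  Lp ℝ 2 ((volume : Measure (EuclideanSpace ℝ (Fin n))).restrict Ω)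

/-- The phase space `C = C([-r, 0]; L²(Ω))` with the maximum norm. -/
abbrev Phase {n : ℕ} (r : ℝ) (Ω : Set (EuclideanSpace ℝ (Fin n))) : Type :=
  C(Icc (-r) 0, L2 Ω)

section Delay

variable {n : ℕ} {Ω : Set (EuclideanSpace ℝ (Fin n))} {r : ℝ} {ι : Type*}

/-- The splitting `g = g_d + g_ac + g_s` for every state `φ`. -/
structure IsSplitting (hr : 0 < r) (g gd gac gs : Icc (-r) 0 → Phase r Ω → ℝ) : Prop where
  sum_eq : ∀ θ φ, g θ φ = gd θ φ + gac θ φ + gs θ φ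
  step : ∀ φ, IsStepFunction (fun θ => gd θ φ)
  absolutelyContinuous : ∀ φ, IsAbsolutelyContinuous hr (fun θ => gac θ φ)
  singular : ∀ φ, IsSingularContinuous hr (fun θ => gs θ φ)

/-- (A1) `g(·, φ)` is of bounded variation, uniformly in `φ`. -/
def UniformlyBoundedVariation (g : Icc (-r) 0 → Phase r Ω → ℝ) : Prop :=
  ∃ M : ℝ, 0 < M ∧ ∀ φ, eVariationOn (fun θ => g θ φ) univ ≤ ENNReal.ofReal M

/-- (A2) `g_ac(θ, ·)` and `g_s(θ, ·)` are continuous for every `θ`. -/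
def ContinuousInState (gac gs : Icc (-r) 0 → Phase r Ω → ℝ) : Prop :=
  ∀ θ, Continuous (gac θ) ∧ Continuous (gs θ)

/-- (A3) The step function `g_d(·, φ)` jumps by `h_k(φ)` at `-η_k(φ)`, with continuous
`η_k : C → [0, r]` and `h_k : C → ℝ`, and `∑ |h_k(φ)|` converges uniformly on bounded sets.
Where several of the points `-η_k(φ)` coincide, the jump is the sum of their `h_k(φ)`. -/
structure ContinuousDiscreteDelays (gd : Icc (-r) 0 → Phase r Ω → ℝ)
    (η h : ι → Phase r Ω → ℝ) : Prop where
  delay_mem : ∀ k φ, η k φ ∈ Icc 0 r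
  delay_continuous : ∀ k, Continuous (η k)
  jump_continuous : ∀ k, Continuous (h k)
  summable : ∀ φ, Summable (fun k => |h k φ|)
  jump_eq : ∀ φ (θ : Icc (-r) 0),
    jump (fun θ' => gd θ' φ) θ = ∑' k : {k : ι // (θ : ℝ) = -η k φ}, h k φ
  uniform : ∀ B : Set (Phase r Ω), Bornology.IsBounded B →
    TendstoUniformlyOn (fun (s : Finset ι) φ => ∑ k ∈ s, |h k φ|) (fun φ => ∑' k, |h k φ|) atTop B

/-- (A4) The total variation of `g_c = g_ac + g_s` is Lipschitz in the state. -/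
def LipschitzVariation (gac gs : Icc (-r) 0 → Phase r Ω → ℝ) : Prop :=
  ∃ L : ℝ, 0 ≤ L ∧ ∀ φ ψ : Phase r Ω,
    eVariationOn (fun θ => (gac θ φ + gs θ φ) - (gac θ ψ + gs θ ψ)) univ
      ≤ ENNReal.ofReal (L * ‖φ - ψ‖)

/-- (A5) The uniform ignoring condition: no `η_k`, `h_k` depends on the values of the state on
`(-η_ign, 0]`. -/
def UniformIgnoring (η h : ι → Phase r Ω → ℝ) : Prop :=
  ∃ ηign : ℝ, 0 < ηign ∧ ∀ φ ψ : Phase r Ω,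
    (∀ θ : Icc (-r) 0, (θ : ℝ) ≤ -ηign → φ θ = ψ θ) →
      ∀ k, η k φ = η k ψ ∧ h k φ = h k ψ

/-- The function `x ↦ ∫_{-r}^0 {∫_Ω b(φ(θ)(y)) f(x - y) dy} dg(θ, φ)`. -/
def delayFun (b : ℝ → ℝ) (f : EuclideanSpace ℝ (Fin n) → ℝ) (g : Icc (-r) 0 → Phase r Ω → ℝ)
    (φ : Phase r Ω) (x : EuclideanSpace ℝ (Fin n)) : ℝ :=
  stieltjesIntegral (fun θ => ∫ y in Ω, b (φ θ y) * f (x - y)) (fun θ => g θ φ)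

/-- The delay term `F : C → L²(Ω)`: the class of `delayFun b f g φ` in `L²(Ω)`. -/
def delayTerm (b : ℝ → ℝ) (f : EuclideanSpace ℝ (Fin n) → ℝ) (g : Icc (-r) 0 → Phase r Ω → ℝ)
    (φ : Phase r Ω) : L2 Ω :=
  open Classical in
  if h : MemLp (delayFun b f g φ) 2 (volume.restrict Ω) then h.toLp _ else 0

end Delay

/-! ### Mild solutions -/

section Mild

variable {H : Type*} [NormedAddCommGroup H] [InnerProductSpace ℝ H]

lemma neg_le_of_pos {r T : ℝ} (hr : 0 < r) (hT : 0 < T) : -r ≤ T := by linarith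

/-- The segment `u_t(θ) = u(t + θ)`, `θ ∈ [-r, 0]`, of `u ∈ C([-r, T]; H)` for `t ∈ [0, T]`. (The
projection onto `[-r, T]` is the identity at the points `t + θ` for such `t`.) -/
def segment {r T : ℝ} (hr : 0 < r) (hT : 0 < T) (u : C(Icc (-r) T, H)) (t : ℝ) :
    C(Icc (-r) 0, H) where
  toFun θ := u (projIcc (-r) T (neg_le_of_pos hr hT) (t + θ))
  continuous_toFun := by
    exact u.continuous.comp (continuous_projIcc.comp (continuous_const.add continuous_subtype_val))

/-- `u ∈ C([-r, T]; H)` is a mild solution on `[-r, T]` of `u' + A u + d u = F(u_t)`,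
`u|_{[-r, 0]} = φ`. -/
structure IsMildSolution [CompleteSpace H] {r T : ℝ} (hr : 0 < r) (hT : 0 < T)
    (A : H →ₗ.[ℝ] H) (d : ℝ) (F : C(Icc (-r) 0, H) → H) (φ : C(Icc (-r) 0, H))
    (u : C(Icc (-r) T, H)) : Prop where
  initial : ∀ θ : Icc (-r) 0, u ⟨θ, θ.2.1, θ.2.2.trans hT.le⟩ = φ θ
  integrable : ∀ t ∈ Icc 0 T, IntervalIntegrable (fun s => expNeg A (t - s)
    (F (segment hr hT u s) - d • u (projIcc (-r) T (neg_le_of_pos hr hT) s))) volume 0 t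
  eq : ∀ t (ht : t ∈ Icc 0 T), u ⟨t, (neg_lt_zero.2 hr).le.trans ht.1, ht.2⟩ =
    expNeg A t (φ ⟨0, neg_nonpos.2 hr.le, le_rfl⟩) + ∫ s in (0 : ℝ)..t, expNeg A (t - s)
      (F (segment hr hT u s) - d • u (projIcc (-r) T (neg_le_of_pos hr hT) s))

/-- The restriction to `[-r, T]` of `u ∈ C([-r, ∞); H)`. -/
def restrictTo {r : ℝ} (T : ℝ) (u : C(Ici (-r), H)) : C(Icc (-r) T, H) :=
  u.comp ⟨Set.inclusion Icc_subset_Ici_self, continuous_inclusion Icc_subset_Ici_self⟩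

end Mild

end DelayPDE

end

/-! The obstacle is that `F` need not be Lipschitz: through the state-dependent points `-η k φ` the
state is evaluated at places that move with the state, so a contraction argument does not apply
directly. The remedy is to separate the two roles of the state. Write `F φ - d • φ 0 = G φ φ`, where
`G ψ χ` takes the delays `η k` and jumps `h k` from `ψ` and everything else from `χ`. Then `G` is
jointly continuous, and Lipschitz in `χ` with a constant `ℓ ψ` depending continuously on `ψ`; by
(A5), `G ψ` sees `ψ` only on `[-r, -δ]` (`exists_isIgnoringFactorization`).

If a solution is known up to time `a`, then for times up to `a + δ` the first argument of `G` is
therefore already known. What remains is an equation with a Lipschitz right-hand side, solved by the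
Banach fixed point theorem in an exponentially weighted norm (`exists_extension`). Steps of the
fixed length `δ` reach every time. Continuous dependence goes through the same steps: convergence up
to `a` makes the first arguments converge, and a Gronwall estimate carries the convergence to `a +
δ` (`tendsto_clip_extension`). Uniqueness is continuous dependence for constant sequences. Of
`e^{-tA}` only strong continuity, the contraction property and the value at `0` are needed; they
follow from the expansion in eigenspaces, which are total because the resolvent is compact and
symmetric.

To obtain `G`, the Stieltjes measure of `g(·, φ)` is decomposed into `∑ h_k δ_{-η_k}` and the
measure of `g_c` (`stieltjesMeasure_splitting`). The latter is atomless and the former is carried by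
a countable set, so (A1) for `g` passes to `g_c`. Together with (A4) and the Lipschitz property of
`b`, this makes the continuous part Lipschitz (`norm_continuousTerm_sub_le`). The discrete part is a
series whose continuity comes from the uniform convergence in (A3). -/

namespace DelayPDE

/-! ### Stieltjes measures of functions of bounded variation and their total mass. -/

section StieltjesVectorMeasure

set_option linter.unusedSectionVars false

variable {α : Type*} [LinearOrder α] [DenselyOrdered α] [TopologicalSpace α] [OrderTopology α]
  [SecondCountableTopology α] [CompactIccSpace α] [MeasurableSpace α] [BorelSpace α]
  [BoundedOrder α]

instance isFiniteMeasure_variation_signedMeasure {X : Type*} [MeasurableSpace X]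
    (μ : SignedMeasure X) : IsFiniteMeasure μ.variation := by
  rw [← SignedMeasure.totalVariation_eq_variation]
  unfold SignedMeasure.totalVariation
  infer_instance

/-- The sets `Iic a` form a π-system generating the Borel σ-algebra, and `⊤` makes the whole space
one of them, so total masses need no separate comparison. -/
lemma vectorMeasure_ext_Iic {μ ν : SignedMeasure α} (h : ∀ a, μ (Iic a) = ν (Iic a)) : μ = ν := by
  refine VectorMeasure.ext_of_generateFrom (range Iic) ?_ ?_ ?_ ?_
  · rintro _ ⟨a, rfl⟩
    exact h a
  · borelize α
    exact borel_eq_generateFrom_Iic α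
  · rintro _ ⟨a, rfl⟩ _ ⟨b, rfl⟩ _
    exact ⟨a ⊓ b, (Iic_inter_Iic).symm⟩
  · simpa using h ⊤

lemma vectorMeasure_apply_Iic {f : α → ℝ} (hf : BoundedVariationOn f univ) (a : α) :
    hf.vectorMeasure (Iic a) = f.rightLim a - f ⊥ := by
  rw [← Icc_bot, hf.vectorMeasure_Icc bot_le, leftLim_eq_of_isBot isBot_bot]

lemma rightLim_sub {f g : α → ℝ} (hf : BoundedVariationOn f univ)
    (hg : BoundedVariationOn g univ) (a : α) :
    Function.rightLim (fun x => f x - g x) a = f.rightLim a - g.rightLim a := by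
  rcases eq_or_neBot (𝓝[>] a) with h | h
  · simp [rightLim_eq_of_eq_bot _ h]
  · exact rightLim_eq_of_tendsto ((hf.tendsto_rightLim a).sub (hg.tendsto_rightLim a))

lemma vectorMeasure_sub {f g : α → ℝ} (hf : BoundedVariationOn f univ)
    (hg : BoundedVariationOn g univ) (hfg : BoundedVariationOn (fun x => f x - g x) univ) :
    hfg.vectorMeasure = hf.vectorMeasure - hg.vectorMeasure := by
  refine vectorMeasure_ext_Iic fun a => ?_
  rw [sub_apply]
  simp only [vectorMeasure_apply_Iic, rightLim_sub hf hg]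
  ring

lemma edist_rightLim_le {f : α → ℝ} (hf : BoundedVariationOn f univ) (a : α) :
    edist (f a) (f.rightLim a) ≤ eVariationOn f univ := by
  rcases eq_or_neBot (𝓝[>] a) with h | h
  · simp [rightLim_eq_of_eq_bot _ h]
  · refine le_of_tendsto (tendsto_const_nhds.edist (hf.tendsto_rightLim a)) ?_
    exact Eventually.of_forall fun x => eVariationOn.edist_le f (mem_univ _) (mem_univ _)

/-- The total mass of the Stieltjes measure is controlled by the total variation. -/
lemma variation_vectorMeasure_univ_le {f : α → ℝ} (hf : BoundedVariationOn f univ) :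
    hf.vectorMeasure.variation univ ≤ 2 * eVariationOn f univ := by
  -- The positive measure of the variation function of `f.rightLim`. It dominates the increments of
  -- `f.rightLim` on half-open intervals, but gives no mass to `{⊥}`.
  set ρ := (hf.stieltjesFunctionRightLim ⊥).measure with hρ
  have hρu : ρ univ ≤ eVariationOn f univ := by
    have h1 : (univ : Set α) = {⊥} ∪ Ioc ⊥ ⊤ := by
      ext x; simp
    have h2 : ρ {⊥} = 0 := by
      rw [← botSet_eq_singleton_of_isBot isBot_bot]
      exact StieltjesFunction.measure_botSet _
    have h3 : ρ univ ≤ ρ {⊥} + ρ (Ioc ⊥ ⊤) :=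
      (congrArg ρ h1).trans_le (measure_union_le _ _)
    refine h3.trans ?_
    rw [h2, zero_add, hρ, StieltjesFunction.measure_Ioc]
    simp only [BoundedVariationOn.stieltjesFunctionRightLim_apply, variationOnFromTo, bot_le,
      le_refl, ite_true, univ_inter]
    refine le_trans ?_ (eVariationOn.eVariationOn_rightLim_le (f := f) isOpen_univ)
    refine ENNReal.ofReal_le_of_le_toReal ?_
    refine (sub_le_self _ ENNReal.toReal_nonneg).trans ?_
    exact ENNReal.toReal_mono hf.rightLim (eVariationOn.mono _ (subset_univ _))
  have hρfin : IsFiniteMeasure ρ := ⟨hρu.trans_lt hf.lt_top⟩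
  have A : ∀ s ∈ {s | ∃ u v : α, u ≤ v ∧ s = Ioc u v},
      ‖AddContent.onIoc f.rightLim s‖ₑ ≤ ρ s := by
    rintro s ⟨u, v, huv, rfl⟩
    rw [AddContent.onIoc_apply huv, hρ, StieltjesFunction.measure_Ioc]
    simp only [BoundedVariationOn.stieltjesFunctionRightLim_apply]
    rw [← variationOnFromTo.add hf.rightLim.locallyBoundedVariationOn
      (mem_univ ⊥) (mem_univ u) (mem_univ v)]
    simp only [add_sub_cancel_left, variationOnFromTo, huv, ↓reduceIte, univ_inter]
    rw [ENNReal.ofReal_toReal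
      ((eVariationOn.mono _ (subset_univ _)).trans_lt hf.rightLim.lt_top).ne,
      ← edist_eq_enorm_sub]
    exact eVariationOn.edist_le _ (right_mem_Icc.2 huv) (left_mem_Icc.2 huv)
  have B : (inferInstance : MeasurableSpace α) =
      MeasurableSpace.generateFrom {s | ∃ u v : α, u ≤ v ∧ s = Ioc u v} := by
    borelize α
    convert! borel_eq_generateFrom_Ioc_le α using 2
    grind only
  obtain ⟨m, hm, hmρ⟩ :=
    VectorMeasure.exists_extension_of_isSetSemiring_of_le_measure_of_generateFrom
      IsSetSemiring.Ioc A B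
  have hbot : m {⊥} = 0 := by
    have h2 : ρ {⊥} = 0 := by
      rw [← botSet_eq_singleton_of_isBot isBot_bot]
      exact StieltjesFunction.measure_botSet _
    have := hmρ {⊥}
    rw [h2] at this
    exact enorm_eq_zero.1 (le_antisymm this (by positivity))
  -- The measure `m` built from half-open intervals misses the jump of `f` at `⊥`. The Dirac mass
  -- restores it, at the cost of a second copy of the variation: hence the factor 2.
  have key : hf.vectorMeasure = m + VectorMeasure.dirac ⊥ (f.rightLim ⊥ - f ⊥) := by
    refine vectorMeasure_ext_Iic fun a => ?_
    have h1 : Iic a = {⊥} ∪ Ioc ⊥ a := by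
      ext x
      rcases eq_bot_or_bot_lt x with rfl | h
      · simp
      · simp
    have h2 : m (Iic a) = f.rightLim a - f.rightLim ⊥ := by
      rw [h1, VectorMeasure.of_union (by simp) (measurableSet_singleton _) measurableSet_Ioc, hbot,
        zero_add, hm _ ⟨⊥, a, bot_le, rfl⟩, AddContent.onIoc_apply bot_le]
    rw [add_apply, h2, vectorMeasure_apply_Iic,
      VectorMeasure.dirac_apply_of_mem measurableSet_Iic (mem_Iic.2 bot_le)]
    ring
  rw [key, two_mul]
  refine (VectorMeasure.variation_add_le univ).trans ?_
  rw [Measure.add_apply]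
  refine add_le_add ((VectorMeasure.variation_le_of_forall_enorm_le (fun E _ => hmρ E) univ).trans
    hρu) ?_
  rw [VectorMeasure.variation_dirac]
  simp only [Measure.smul_apply, measure_univ, smul_eq_mul, mul_one]
  rw [← edist_eq_enorm_sub, edist_comm]
  exact edist_rightLim_le hf ⊥

end StieltjesVectorMeasure

/-! ### Purely atomic signed measures. -/

section Atomic

variable {X : Type*} [MeasurableSpace X]

lemma integral_lsmul_toSignedMeasure (ν : Measure X) [IsFiniteMeasure ν] (χ : X → ℝ) :
    ν.toSignedMeasure.integral χ (ContinuousLinearMap.lsmul ℝ ℝ) = ∫ x, χ x ∂ν := by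
  rw [← VectorMeasure.integral_toSignedMeasure]
  congr 1
  ext
  simp

/-- Reduces a signed integral to two positive ones, for which measurable dependence on a parameter
is available. -/
lemma integral_eq_integral_posPart_sub_negPart (μ : SignedMeasure X) {χ : X → ℝ}
    (hχ : Measurable χ) {C : ℝ} (hC : ∀ x, |χ x| ≤ C) :
    μ.integral χ (ContinuousLinearMap.lsmul ℝ ℝ) =
      ∫ x, χ x ∂μ.toJordanDecomposition.posPart - ∫ x, χ x ∂μ.toJordanDecomposition.negPart := by
  conv_lhs => rw [← μ.toSignedMeasure_toJordanDecomposition]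
  unfold JordanDecomposition.toSignedMeasure
  have h : ∀ ν : SignedMeasure X, ν.Integrable χ := fun ν =>
    Integrable.of_bound (μ := ν.variation) hχ.aestronglyMeasurable C (Eventually.of_forall hC)
  rw [VectorMeasure.integral_sub_vectorMeasure (h _) (h _), integral_lsmul_toSignedMeasure,
    integral_lsmul_toSignedMeasure]

/-- The signed measure `∑ c_k δ_{x_k}` for an absolutely convergent series `∑ c_k`. -/
lemma exists_signedMeasure_tsum_dirac {κ : Type*} [Countable κ] (c : κ → ℝ) (x : κ → X)
    (hc : Summable fun k => |c k|) :
    ∃ ρ : SignedMeasure X,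
      (∀ E, MeasurableSet E → ρ E = ∑' k, E.indicator (fun _ => c k) (x k)) ∧
      ∀ χ : X → ℝ, Measurable χ → ∀ C, (∀ y, |χ y| ≤ C) →
        ρ.integral χ (ContinuousLinearMap.lsmul ℝ ℝ) = ∑' k, c k * χ (x k) := by
  have main : ∀ a : κ → ℝ≥0, Summable a → ∃ ν : Measure X, IsFiniteMeasure ν ∧
      ∀ χ : X → ℝ, Measurable χ → ∀ C, (∀ y, |χ y| ≤ C) → ∫ y, χ y ∂ν = ∑' k, a k * χ (x k) := by
    intro a ha
    refine ⟨Measure.sum fun k => a k • Measure.dirac (x k), ⟨?_⟩, ?_⟩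
    · rw [Measure.sum_apply _ MeasurableSet.univ]
      simp only [Measure.smul_apply, measure_univ]
      have : (∑' k, (a k : ℝ≥0∞)) ≠ ∞ := ENNReal.tsum_coe_ne_top_iff_summable.2 ha
      simpa only [ENNReal.smul_def, smul_eq_mul, mul_one] using this.lt_top
    · intro χ hχ C hC
      have hfin : IsFiniteMeasure (Measure.sum fun k => a k • Measure.dirac (x k)) := by
        refine ⟨?_⟩
        rw [Measure.sum_apply _ MeasurableSet.univ]
        have : (∑' k, (a k : ℝ≥0∞)) ≠ ∞ := ENNReal.tsum_coe_ne_top_iff_summable.2 ha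
        simpa only [Measure.smul_apply, measure_univ, ENNReal.smul_def, smul_eq_mul, mul_one]
          using this.lt_top
      have hi : Integrable χ (Measure.sum fun k => a k • Measure.dirac (x k)) :=
        Integrable.of_bound hχ.aestronglyMeasurable C (Eventually.of_forall hC)
      rw [integral_sum_measure hi]
      refine tsum_congr fun k => ?_
      rw [integral_smul_nnreal_measure, integral_dirac' _ _ hχ.stronglyMeasurable, NNReal.smul_def,
        smul_eq_mul]
  have hs1 : Summable fun k => (c k).toNNReal := by
    rw [← NNReal.summable_coe]
    refine hc.of_nonneg_of_le (fun k => by positivity) fun k => ?_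
    rw [Real.coe_toNNReal']
    exact max_le (le_abs_self _) (abs_nonneg _)
  have hs2 : Summable fun k => (-c k).toNNReal := by
    rw [← NNReal.summable_coe]
    refine hc.of_nonneg_of_le (fun k => by positivity) fun k => ?_
    rw [Real.coe_toNNReal']
    exact max_le (neg_le_abs _) (abs_nonneg _)
  obtain ⟨ν₁, hν₁, h₁⟩ := main _ hs1
  obtain ⟨ν₂, hν₂, h₂⟩ := main _ hs2
  have key : ∀ χ : X → ℝ, Measurable χ → ∀ C, (∀ y, |χ y| ≤ C) →
      ∫ y, χ y ∂ν₁ - ∫ y, χ y ∂ν₂ = ∑' k, c k * χ (x k) := by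
    intro χ hχ C hC
    have hsum : ∀ a : κ → ℝ≥0, Summable a → Summable fun k => (a k : ℝ) * χ (x k) := by
      intro a ha
      refine Summable.of_norm_bounded ((NNReal.summable_coe.2 ha).mul_right C) fun k => ?_
      rw [norm_mul, Real.norm_eq_abs, NNReal.abs_eq]
      exact mul_le_mul_of_nonneg_left (hC _) (by positivity)
    rw [h₁ χ hχ C hC, h₂ χ hχ C hC, ← (hsum _ hs1).tsum_sub (hsum _ hs2)]
    refine tsum_congr fun k => ?_
    rw [← sub_mul, Real.coe_toNNReal', Real.coe_toNNReal']
    congr 1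
    exact max_zero_sub_max_neg_zero_eq_self (c k)
  refine ⟨ν₁.toSignedMeasure - ν₂.toSignedMeasure, ?_, ?_⟩
  · intro E hE
    have := key (E.indicator 1) (measurable_one.indicator hE) 1 (by
      intro y; by_cases hy : y ∈ E <;> simp [hy])
    rw [integral_indicator_one hE, integral_indicator_one hE] at this
    rw [sub_apply, Measure.toSignedMeasure_apply_measurable hE,
      Measure.toSignedMeasure_apply_measurable hE, this]
    refine tsum_congr fun k => ?_
    by_cases hy : x k ∈ E <;> simp [hy]
  · intro χ hχ C hC
    have h : ∀ ν : SignedMeasure X, ν.Integrable χ := fun ν =>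
      Integrable.of_bound (μ := ν.variation) hχ.aestronglyMeasurable C (Eventually.of_forall hC)
    rw [VectorMeasure.integral_sub_vectorMeasure (h _) (h _), integral_lsmul_toSignedMeasure,
      integral_lsmul_toSignedMeasure, key χ hχ C hC]

/-- A signed measure is determined on a countable set by the masses of the points. -/
lemma signedMeasure_eq_of_countable [MeasurableSingletonClass X] {μ ν : SignedMeasure X}
    {E : Set X} (hE : E.Countable) (h : ∀ x ∈ E, μ {x} = ν {x}) : μ E = ν E := by
  have : Countable E := hE.to_subtype
  have hU : E = ⋃ x : E, {(x : X)} := by ext; simp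
  have hd : Pairwise (Function.onFun Disjoint fun x : E => ({(x : X)} : Set X)) := by
    intro x y hxy
    simpa [Function.onFun, Subtype.ext_iff] using hxy
  rw [hU, VectorMeasure.of_disjoint_iUnion (fun _ => measurableSet_singleton _) hd,
    VectorMeasure.of_disjoint_iUnion (fun _ => measurableSet_singleton _) hd]
  exact tsum_congr fun x => h x x.2

end Atomic

/-! ### Stieltjes integrals on `[-r, 0]` and their splitting into jumps and a continuous part. -/

lemma eVariationOn_sub_le {α : Type*} [LinearOrder α] (f g : α → ℝ) (s : Set α) :
    eVariationOn (fun x => f x - g x) s ≤ eVariationOn f s + eVariationOn g s := by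
  refine iSup_le fun p => ?_
  refine le_trans (Finset.sum_le_sum (g := fun i =>
    edist (f (p.2.1 (i + 1))) (f (p.2.1 i)) + edist (g (p.2.1 (i + 1))) (g (p.2.1 i)))
    fun i _ => ?_) ?_
  · simp only [edist_dist, ← ENNReal.ofReal_add dist_nonneg dist_nonneg]
    exact ENNReal.ofReal_le_ofReal (dist_sub_sub_le _ _ _ _)
  · rw [Finset.sum_add_distrib]
    exact add_le_add (eVariationOn.sum_le p.2.2.1 p.2.2.2)
      (eVariationOn.sum_le p.2.2.1 p.2.2.2)

lemma boundedVariationOn_sub {α : Type*} [LinearOrder α] {f g : α → ℝ} {s : Set α}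
    (hf : BoundedVariationOn f s) (hg : BoundedVariationOn g s) :
    BoundedVariationOn (fun x => f x - g x) s :=
  ((eVariationOn_sub_le f g s).trans_lt (ENNReal.add_lt_top.2 ⟨hf.lt_top, hg.lt_top⟩)).ne

lemma IsAbsolutelyContinuous.continuous {r : ℝ} {hr : 0 < r} {G : Icc (-r) 0 → ℝ}
    (hG : IsAbsolutelyContinuous hr G) : Continuous G := by
  have h := AbsolutelyContinuousOnInterval.continuousOn hG
  rw [uIcc_of_le (by linarith)] at h
  have h' := continuousOn_iff_continuous_domRestrict.1 h
  convert h' using 1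
  ext θ
  simp

lemma IsAbsolutelyContinuous.boundedVariationOn {r : ℝ} {hr : 0 < r} {G : Icc (-r) 0 → ℝ}
    (hG : IsAbsolutelyContinuous hr G) : BoundedVariationOn G univ := by
  have h := AbsolutelyContinuousOnInterval.boundedVariationOn hG
  rw [uIcc_of_le (by linarith)] at h
  have h1 := eVariationOn.comp_le_of_monotoneOn (IccExtend (neg_nonpos.2 hr.le) G)
    (s := Icc (-r) 0) (t := univ) (Subtype.val : Icc (-r) 0 → ℝ)
    (fun _ _ _ _ h => h) (fun x _ => x.2)
  have h2 : IccExtend (neg_nonpos.2 hr.le) G ∘ (Subtype.val : Icc (-r) 0 → ℝ) = G := by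
    ext θ
    simp
  rw [h2] at h1
  exact (h1.trans_lt h.lt_top).ne

section StieltjesOfInterval

variable {r : ℝ}

lemma stieltjesMeasure_of_boundedVariationOn {G : Icc (-r) 0 → ℝ}
    (hG : BoundedVariationOn G univ) : stieltjesMeasure G = hG.vectorMeasure := by
  simp [stieltjesMeasure, hG]

lemma stieltjesMeasure_singleton {G : Icc (-r) 0 → ℝ} (hG : BoundedVariationOn G univ)
    (θ : Icc (-r) 0) : stieltjesMeasure G {θ} = jump G θ := by
  rw [stieltjesMeasure_of_boundedVariationOn hG, hG.vectorMeasure_singleton, jump]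

lemma stieltjesMeasure_sub (hr : 0 < r) {f g : Icc (-r) 0 → ℝ} (hf : BoundedVariationOn f univ)
    (hg : BoundedVariationOn g univ) :
    stieltjesMeasure (fun θ => f θ - g θ) = stieltjesMeasure f - stieltjesMeasure g := by
  have : Fact (-r ≤ 0) := ⟨by linarith⟩
  rw [stieltjesMeasure_of_boundedVariationOn hf, stieltjesMeasure_of_boundedVariationOn hg,
    stieltjesMeasure_of_boundedVariationOn (boundedVariationOn_sub hf hg), vectorMeasure_sub hf hg]

lemma variation_stieltjesMeasure_univ_le (hr : 0 < r) {G : Icc (-r) 0 → ℝ}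
    (hG : BoundedVariationOn G univ) :
    (stieltjesMeasure G).variation univ ≤ 2 * eVariationOn G univ := by
  have : Fact (-r ≤ 0) := ⟨by linarith⟩
  rw [stieltjesMeasure_of_boundedVariationOn hG]
  exact variation_vectorMeasure_univ_le hG

lemma abs_integral_le_of_variation_le {X : Type*} [MeasurableSpace X] {μ : SignedMeasure X}
    {χ : X → ℝ} {C V : ℝ} (hC0 : 0 ≤ C) (hV0 : 0 ≤ V) (hC : ∀ x, |χ x| ≤ C)
    (hV : μ.variation univ ≤ ENNReal.ofReal V) :
    |μ.integral χ (ContinuousLinearMap.lsmul ℝ ℝ)| ≤ V * C := by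
  have h := VectorMeasure.norm_integral_le_of_norm_le_const (μ := μ) (f := χ)
    (B := ContinuousLinearMap.lsmul ℝ ℝ) (C := C) (Eventually.of_forall hC)
  rw [ContinuousLinearMap.opNorm_lsmul, mul_one] at h
  refine h.trans ?_
  rw [mul_comm]
  refine mul_le_mul_of_nonneg_right ?_ hC0
  exact ENNReal.toReal_le_of_le_ofReal hV0 hV

lemma abs_stieltjesIntegral_le (hr : 0 < r) {χ G : Icc (-r) 0 → ℝ} {C V : ℝ} (hC0 : 0 ≤ C)
    (hV0 : 0 ≤ V) (hC : ∀ θ, |χ θ| ≤ C) (hV : eVariationOn G univ ≤ ENNReal.ofReal V) :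
    |stieltjesIntegral χ G| ≤ 2 * V * C := by
  have hG : BoundedVariationOn G univ := (hV.trans_lt ENNReal.ofReal_lt_top).ne
  refine abs_integral_le_of_variation_le hC0 (by positivity) hC ?_
  refine (variation_stieltjesMeasure_univ_le hr hG).trans ?_
  rw [ENNReal.ofReal_mul (by norm_num)]
  simpa using mul_le_mul_right hV 2

lemma integrable_of_bounded {X : Type*} [MeasurableSpace X] (ν : SignedMeasure X) {χ : X → ℝ}
    (hχ : Measurable χ) {C : ℝ} (hC : ∀ x, |χ x| ≤ C) : ν.Integrable χ :=
  Integrable.of_bound (μ := ν.variation) hχ.aestronglyMeasurable C (Eventually.of_forall hC)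

lemma stieltjesIntegral_sub_right (hr : 0 < r) {χ f g : Icc (-r) 0 → ℝ} (hχ : Measurable χ)
    {C : ℝ} (hC : ∀ θ, |χ θ| ≤ C) (hf : BoundedVariationOn f univ)
    (hg : BoundedVariationOn g univ) :
    stieltjesIntegral χ (fun θ => f θ - g θ) = stieltjesIntegral χ f - stieltjesIntegral χ g := by
  unfold stieltjesIntegral
  rw [stieltjesMeasure_sub hr hf hg, VectorMeasure.integral_sub_vectorMeasure
    (integrable_of_bounded _ hχ hC) (integrable_of_bounded _ hχ hC)]

lemma stieltjesIntegral_sub_left {χ χ' G : Icc (-r) 0 → ℝ} (hχ : Measurable χ)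
    (hχ' : Measurable χ') {C : ℝ} (hC : ∀ θ, |χ θ| ≤ C) (hC' : ∀ θ, |χ' θ| ≤ C) :
    stieltjesIntegral (fun θ => χ θ - χ' θ) G = stieltjesIntegral χ G - stieltjesIntegral χ' G :=
  VectorMeasure.integral_fun_sub (integrable_of_bounded _ hχ hC) (integrable_of_bounded _ hχ' hC')

/-- The Stieltjes measure of a step function is carried by a countable set. -/
lemma IsStepFunction.exists_countable (hr : 0 < r) {G : Icc (-r) 0 → ℝ} (hG : IsStepFunction G)
    (hGbv : BoundedVariationOn G univ) :
    ∃ D : Set (Icc (-r) 0), D.Countable ∧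
      ∀ E, MeasurableSet E → Disjoint E D → stieltjesMeasure G E = 0 := by
  have : Fact (-r ≤ 0) := ⟨by linarith⟩
  obtain ⟨c, x, a, a', ha, ha', hG⟩ := hG
  -- The mass at `x n` is `a n + a' n` except at the end points: at `⊤` the strict inequality never
  -- lets `a n` contribute, and at `⊥` the term `a' n` is already contained in `G ⊥`, so it is not a
  -- jump.
  have hc : Summable fun n => |(if x n = ⊤ then 0 else a n) + (if x n = ⊥ then 0 else a' n)| := by
    refine (ha.add ha').of_nonneg_of_le (fun n => abs_nonneg _) fun n => ?_
    refine (abs_add_le _ _).trans (add_le_add ?_ ?_) <;> split_ifs <;> simp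
  obtain ⟨ρ, hρ, -⟩ := exists_signedMeasure_tsum_dirac _ x hc
  have hind : ∀ (p : ℕ → Prop) [DecidablePred p] (u : ℕ → ℝ), Summable (fun n => |u n|) →
      Summable fun n => if p n then u n else 0 := by
    intro p _ u hu
    refine Summable.of_norm_bounded hu fun n => ?_
    split_ifs <;> simp
  have key : stieltjesMeasure G = ρ := by
    rw [stieltjesMeasure_of_boundedVariationOn hGbv]
    refine vectorMeasure_ext_Iic fun θ => ?_
    rw [vectorMeasure_apply_Iic, hρ _ measurableSet_Iic]
    have hbot : G ⊥ = c + ∑' n, if x n = ⊥ then a' n else 0 := by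
      rw [hG]; simp
    have hlim : Function.rightLim G θ = c + (∑' n, if x n ≤ θ ∧ x n ≠ ⊤ then a n else 0) +
        ∑' n, if x n ≤ θ then a' n else 0 := by
      rcases eq_or_ne θ ⊤ with rfl | hθ
      · rw [rightLim_eq_of_isTop isTop_top, hG]
        simp [lt_top_iff_ne_top]
      · have : (𝓝[>] θ).NeBot := nhdsGT_neBot_of_exists_gt ⟨⊤, lt_top_iff_ne_top.2 hθ⟩
        refine rightLim_eq_of_tendsto ?_
        -- For fixed `n`, just to the right of `θ` both kinds of inequality reduce to `x n ≤ θ`;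
        -- dominated convergence then gives the right limit of the two series.
        have hev : ∀ n, ∀ᶠ τ in 𝓝[>] θ, (x n < τ ↔ x n ≤ θ) ∧ (x n ≤ τ ↔ x n ≤ θ) := by
          intro n
          rcases le_or_gt (x n) θ with h | h
          · filter_upwards [self_mem_nhdsWithin] with τ hτ
            exact ⟨iff_of_true (h.trans_lt hτ) h, iff_of_true (h.trans (le_of_lt hτ)) h⟩
          · filter_upwards [Ioo_mem_nhdsGT h] with τ hτ
            exact ⟨iff_of_false hτ.2.not_gt h.not_ge, iff_of_false hτ.2.not_ge h.not_ge⟩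
        have hGf : G = fun τ => c + (∑' n, if x n < τ then a n else 0) +
          ∑' n, if x n ≤ τ then a' n else 0 := funext hG
        rw [hGf]
        refine (tendsto_const_nhds.add ?_).add ?_
        · refine tendsto_tsum_of_dominated_convergence ha (fun n => ?_)
            (Eventually.of_forall fun τ n => ?_)
          · refine tendsto_const_nhds.congr' ?_
            filter_upwards [hev n] with τ hτ
            have : x n ≤ θ ∧ x n ≠ ⊤ ↔ x n ≤ θ :=
              and_iff_left_of_imp fun h => (h.trans_lt (lt_top_iff_ne_top.2 hθ)).ne
            simp [hτ.1, this]
          · split_ifs <;> simp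
        · refine tendsto_tsum_of_dominated_convergence ha' (fun n => ?_)
            (Eventually.of_forall fun τ n => ?_)
          · refine tendsto_const_nhds.congr' ?_
            filter_upwards [hev n] with τ hτ
            simp [hτ.2]
          · split_ifs <;> simp
    have e : ∑' n, (Iic θ).indicator
        (fun _ => (if x n = ⊤ then 0 else a n) + (if x n = ⊥ then 0 else a' n)) (x n) =
        (∑' n, if x n ≤ θ ∧ x n ≠ ⊤ then a n else 0) +
          ((∑' n, if x n ≤ θ then a' n else 0) - ∑' n, if x n = ⊥ then a' n else 0) := by
      rw [← (hind _ a' ha').tsum_sub (hind _ a' ha'),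
        ← (hind _ a ha).tsum_add ((hind _ a' ha').sub (hind _ a' ha'))]
      refine tsum_congr fun n => ?_
      by_cases h1 : x n ≤ θ
      · rw [indicator_of_mem (mem_Iic.2 h1)]
        simp only [h1, true_and, if_true, ne_eq, ite_not]
        by_cases h3 : x n = ⊥ <;> simp only [h3, if_true, if_false] <;> ring
      · have h3 : x n ≠ ⊥ := fun h => h1 (h ▸ bot_le)
        simp [h1, h3]
    rw [hlim, hbot, e]
    ring
  refine ⟨range x, countable_range x, fun E hE hd => ?_⟩
  rw [key, hρ E hE]
  have : ∀ n, x n ∉ E := fun n hn => Set.disjoint_left.1 hd hn ⟨n, rfl⟩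
  simp [this]

/-- The splitting of the Stieltjes measure of `Gd + Gc` into its atoms and its continuous part. -/
lemma stieltjesMeasure_splitting (hr : 0 < r) {G Gd Gc : Icc (-r) 0 → ℝ}
    (hG : BoundedVariationOn G univ) (hGc : BoundedVariationOn Gc univ) (hcont : Continuous Gc)
    (hsum : ∀ θ, G θ = Gd θ + Gc θ) (hstep : IsStepFunction Gd) {κ : Type*} [Countable κ]
    {c : κ → ℝ} {x : κ → Icc (-r) 0} {ρ : SignedMeasure (Icc (-r) 0)}
    (hρ : ∀ E, MeasurableSet E → ρ E = ∑' k, E.indicator (fun _ => c k) (x k))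
    (hjump : ∀ θ, jump Gd θ = ∑' k : {k // θ = x k}, c k) :
    stieltjesMeasure G = ρ + stieltjesMeasure Gc ∧
      (stieltjesMeasure Gc).variation ≤ (stieltjesMeasure G).variation := by
  have : Fact (-r ≤ 0) := ⟨by linarith⟩
  have hGd' : Gd = fun θ => G θ - Gc θ := by
    ext θ; rw [hsum]; ring
  have hGd : BoundedVariationOn Gd univ := hGd' ▸ boundedVariationOn_sub hG hGc
  obtain ⟨D₀, hD₀, hD₀'⟩ := hstep.exists_countable hr hGd
  -- A countable set carrying both the measure of `Gd` and `ρ`. On it the two are compared point by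
  -- point, and there the atomless measure of `Gc` vanishes.
  set D := D₀ ∪ range x with hD
  have hDc : D.Countable := hD₀.union (countable_range x)
  have hDm : MeasurableSet D := hDc.measurableSet
  have hd_sing : ∀ θ, stieltjesMeasure Gd {θ} = ρ {θ} := by
    intro θ
    rw [stieltjesMeasure_singleton hGd, hjump, hρ _ (measurableSet_singleton θ)]
    refine Eq.trans (tsum_subtype {k | θ = x k} c) (tsum_congr fun k => ?_)
    by_cases h : θ = x k
    · simp [h]
    · simp [h, Ne.symm h]
  have hc_sing : ∀ θ, stieltjesMeasure Gc {θ} = 0 := by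
    intro θ
    rw [stieltjesMeasure_singleton hGc, jump, hcont.continuousWithinAt.rightLim_eq,
      hcont.continuousWithinAt.leftLim_eq, sub_self]
  have hsplit : ∀ (μ : SignedMeasure (Icc (-r) 0)) (E), MeasurableSet E →
      μ E = μ (E ∩ D) + μ (E \ D) := by
    intro μ E hE
    rw [← VectorMeasure.of_union (disjoint_sdiff_inter.symm) (hE.inter hDm) (hE.diff hDm),
      inter_union_sdiff]
  have hdD : ∀ E, MeasurableSet E → stieltjesMeasure Gd (E \ D) = 0 := fun E hE =>
    hD₀' _ (hE.diff hDm) (disjoint_sdiff_left.mono_right subset_union_left)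
  have hcD : ∀ E, MeasurableSet E → stieltjesMeasure Gc (E ∩ D) = 0 := by
    intro E hE
    have := signedMeasure_eq_of_countable (μ := stieltjesMeasure Gc) (ν := 0)
      (hDc.mono inter_subset_right (s₁ := E ∩ D)) (fun θ _ => by simp [hc_sing])
    simpa using this
  have hmeas : stieltjesMeasure Gd = stieltjesMeasure G - stieltjesMeasure Gc := by
    rw [← stieltjesMeasure_sub hr hG hGc, ← hGd']
  constructor
  · have : stieltjesMeasure Gd = ρ := by
      ext E hE
      rw [hsplit _ E hE, hsplit ρ E hE, hdD E hE, signedMeasure_eq_of_countable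
        (hDc.mono inter_subset_right) (fun θ _ => hd_sing θ), hρ _ (hE.diff hDm)]
      have : ∀ k, x k ∉ E \ D := fun k hk => hk.2 (Or.inr ⟨k, rfl⟩)
      simp [this]
    rw [← this, hmeas, sub_add_cancel]
  · refine VectorMeasure.variation_le_of_forall_enorm_le fun E hE => ?_
    -- The continuous part is the restriction of the full measure to the complement of `D`, so its
    -- variation cannot exceed that of the whole.
    have h1 : stieltjesMeasure Gc E = stieltjesMeasure G (E \ D) := by
      have h2 := hdD E hE
      rw [hmeas, sub_apply, sub_eq_zero] at h2
      rw [hsplit _ E hE, hcD E hE, zero_add, h2]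
    rw [h1]
    exact (VectorMeasure.enorm_measure_le_variation _ _).trans (measure_mono sdiff_subset)

/-- The Stieltjes integral with respect to `Gd + Gc` is the series over the jumps plus the integral
with respect to the continuous part, whose total variation is controlled by that of the sum. -/
lemma stieltjesIntegral_splitting (hr : 0 < r) {G Gd Gc : Icc (-r) 0 → ℝ} {V : ℝ} (hV0 : 0 ≤ V)
    (hG : eVariationOn G univ ≤ ENNReal.ofReal V)
    (hGc : BoundedVariationOn Gc univ) (hcont : Continuous Gc)
    (hsum : ∀ θ, G θ = Gd θ + Gc θ) (hstep : IsStepFunction Gd) {κ : Type*} [Countable κ]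
    {c : κ → ℝ} {x : κ → Icc (-r) 0} (hc : Summable fun k => |c k|)
    (hjump : ∀ θ, jump Gd θ = ∑' k : {k // θ = x k}, c k) {χ : Icc (-r) 0 → ℝ}
    (hχ : Measurable χ) {C : ℝ} (hC0 : 0 ≤ C) (hC : ∀ θ, |χ θ| ≤ C) :
    stieltjesIntegral χ G = ∑' k, c k * χ (x k) + stieltjesIntegral χ Gc ∧
      |stieltjesIntegral χ Gc| ≤ 2 * V * C := by
  have hGbv : BoundedVariationOn G univ := (hG.trans_lt ENNReal.ofReal_lt_top).ne
  obtain ⟨ρ, hρ, hρi⟩ := exists_signedMeasure_tsum_dirac c x hc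
  obtain ⟨h1, h2⟩ := stieltjesMeasure_splitting hr hGbv hGc hcont hsum hstep hρ hjump
  constructor
  · unfold stieltjesIntegral
    rw [h1, VectorMeasure.integral_add_vectorMeasure (integrable_of_bounded _ hχ hC)
      (integrable_of_bounded _ hχ hC), hρi χ hχ C hC]
  · refine abs_integral_le_of_variation_le hC0 (by positivity) hC ?_
    refine ((h2 univ).trans (variation_stieltjesMeasure_univ_le hr hGbv)).trans ?_
    rw [ENNReal.ofReal_mul (by norm_num)]
    simpa using mul_le_mul_right hG 2

/-- Measurable dependence of a Stieltjes integral on a parameter. -/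
lemma measurable_stieltjesIntegral {Y : Type*} [MeasurableSpace Y] (G : Icc (-r) 0 → ℝ)
    {χ : Y → Icc (-r) 0 → ℝ} (hχ : ∀ θ, Measurable fun y => χ y θ) (hχc : ∀ y, Continuous (χ y))
    {C : ℝ} (hC : ∀ y θ, |χ y θ| ≤ C) : Measurable fun y => stieltjesIntegral (χ y) G := by
  have h : StronglyMeasurable (Function.uncurry fun (y : Y) (θ : Icc (-r) 0) => χ y θ) := by
    have := stronglyMeasurable_uncurry_of_continuous_of_stronglyMeasurable
      (u := fun (θ : Icc (-r) 0) (y : Y) => χ y θ) hχc (fun θ => (hχ θ).stronglyMeasurable)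
    exact this.comp_measurable measurable_swap
  have : (fun y => stieltjesIntegral (χ y) G) = fun y =>
      ∫ θ, χ y θ ∂(SignedMeasure.toJordanDecomposition (stieltjesMeasure G)).posPart -
        ∫ θ, χ y θ ∂(SignedMeasure.toJordanDecomposition (stieltjesMeasure G)).negPart := by
    ext y
    exact integral_eq_integral_posPart_sub_negPart _ (hχc y).measurable (hC y)
  rw [this]
  exact (h.integral_prod_right.sub h.integral_prod_right).measurable

end StieltjesOfInterval

/-! ### Expansions along an orthogonal family of subspaces. -/

section OrthogonalExpansion

variable {H : Type*} [NormedAddCommGroup H] [InnerProductSpace ℝ H] {κ : Type*}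
  {V : κ → Submodule ℝ H} [∀ i, (V i).HasOrthogonalProjection]

lemma norm_sum_smul_starProjection_sq
    (hV : OrthogonalFamily ℝ (fun i => V i) fun i => (V i).subtypeₗᵢ) (a : κ → ℝ) (v : H)
    (s : Finset κ) :
    ‖∑ i ∈ s, a i • (V i).starProjection v‖ ^ 2 =
      ∑ i ∈ s, a i ^ 2 * ‖(V i).starProjection v‖ ^ 2 := by
  have := hV.norm_sum (fun i => ⟨a i • (V i).starProjection v,
    (V i).smul_mem _ (Submodule.starProjection_apply_mem _ _)⟩) s
  simpa [norm_smul, mul_pow] using this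

/-- Bessel's inequality: the partial sum `p` satisfies `‖p‖² = ⟨v, p⟩ ≤ ‖v‖ ‖p‖`, since each
projection is symmetric and idempotent. -/
lemma sum_norm_starProjection_sq_le
    (hV : OrthogonalFamily ℝ (fun i => V i) fun i => (V i).subtypeₗᵢ) (v : H) (s : Finset κ) :
    ∑ i ∈ s, ‖(V i).starProjection v‖ ^ 2 ≤ ‖v‖ ^ 2 := by
  set p := ∑ i ∈ s, (V i).starProjection v with hp
  have h1 : ‖p‖ ^ 2 = ∑ i ∈ s, ‖(V i).starProjection v‖ ^ 2 := by
    simpa using norm_sum_smul_starProjection_sq hV (fun _ => 1) v s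
  have h2 : inner ℝ v p = ∑ i ∈ s, ‖(V i).starProjection v‖ ^ 2 := by
    rw [hp, inner_sum]
    refine Finset.sum_congr rfl fun i _ => ?_
    rw [← real_inner_self_eq_norm_sq, Submodule.inner_starProjection_left_eq_right,
      Submodule.starProjection_eq_self_iff.2 (Submodule.starProjection_apply_mem _ _)]
  have h3 := real_inner_le_norm v p
  rw [← h1] at h2 ⊢
  nlinarith [norm_nonneg v, norm_nonneg p, sq_nonneg (‖v‖ - ‖p‖)]

lemma summable_norm_starProjection_sq
    (hV : OrthogonalFamily ℝ (fun i => V i) fun i => (V i).subtypeₗᵢ) (v : H) :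
    Summable fun i => ‖(V i).starProjection v‖ ^ 2 :=
  summable_of_sum_le (fun _ => by positivity) (sum_norm_starProjection_sq_le hV v)

/-- The coefficients need a bound only where `v` has a nonzero component: for `t > 0`, `e^{-tc}` is
unbounded over all real `c`, but a positive operator has no negative eigenvalues. -/
lemma summable_mul_norm_starProjection_sq
    (hV : OrthogonalFamily ℝ (fun i => V i) fun i => (V i).subtypeₗᵢ) {a : κ → ℝ} {v : H} {C : ℝ}
    (ha : ∀ i, (V i).starProjection v ≠ 0 → |a i| ≤ C) :
    Summable fun i => a i ^ 2 * ‖(V i).starProjection v‖ ^ 2 := by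
  refine ((summable_norm_starProjection_sq hV v).mul_left (C ^ 2)).of_nonneg_of_le
    (fun _ => by positivity) fun i => ?_
  by_cases h : (V i).starProjection v = 0
  · simp [h]
  · exact mul_le_mul_of_nonneg_right (sq_le_sq' (neg_le_of_abs_le (ha i h))
      (le_of_abs_le (ha i h))) (by positivity)

variable [CompleteSpace H]

lemma summable_smul_starProjection
    (hV : OrthogonalFamily ℝ (fun i => V i) fun i => (V i).subtypeₗᵢ) {a : κ → ℝ} {v : H} {C : ℝ}
    (ha : ∀ i, (V i).starProjection v ≠ 0 → |a i| ≤ C) :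
    Summable fun i => a i • (V i).starProjection v := by
  have := (hV.summable_iff_norm_sq_summable
    (fun i => ⟨a i • (V i).starProjection v,
      (V i).smul_mem _ (Submodule.starProjection_apply_mem _ _)⟩)).2 (by
      simpa [norm_smul, mul_pow] using summable_mul_norm_starProjection_sq hV ha)
  simpa using this

lemma norm_tsum_smul_starProjection_sq
    (hV : OrthogonalFamily ℝ (fun i => V i) fun i => (V i).subtypeₗᵢ) {a : κ → ℝ} {v : H} {C : ℝ}
    (ha : ∀ i, (V i).starProjection v ≠ 0 → |a i| ≤ C) :
    ‖∑' i, a i • (V i).starProjection v‖ ^ 2 =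
      ∑' i, a i ^ 2 * ‖(V i).starProjection v‖ ^ 2 := by
  have h1 := ((summable_smul_starProjection hV ha).hasSum.norm.pow 2)
  have h2 := (summable_mul_norm_starProjection_sq hV ha).hasSum
  refine tendsto_nhds_unique (h1.congr fun s => ?_) h2
  exact norm_sum_smul_starProjection_sq hV a v s

/-- The remainder `v - ∑ P_i v` is orthogonal to every `V i`, hence zero by totality. -/
lemma tsum_starProjection_of_total
    (hV : OrthogonalFamily ℝ (fun i => V i) fun i => (V i).subtypeₗᵢ)
    (htot : (⨆ i, V i)ᗮ = ⊥) (v : H) : ∑' i, (V i).starProjection v = v := by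
  have hs : Summable fun i => (V i).starProjection v := by
    simpa using summable_smul_starProjection hV (a := fun _ => 1) (v := v) (C := 1) (by simp)
  have hmem : v - ∑' i, (V i).starProjection v ∈ (⨆ i, V i)ᗮ := by
    rw [← Submodule.iInf_orthogonal, Submodule.mem_iInf]
    intro i
    rw [Submodule.mem_orthogonal]
    intro u hu
    have h1 : HasSum (fun j => inner ℝ u ((V j).starProjection v))
        (inner ℝ u (∑' i, (V i).starProjection v)) := hs.hasSum.mapL (innerSL ℝ u)
    have h2 : HasSum (fun j => inner ℝ u ((V j).starProjection v))
        (inner ℝ u ((V i).starProjection v)) := by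
      refine hasSum_single i fun j hj => ?_
      exact hV hj.symm ⟨u, hu⟩ ⟨_, Submodule.starProjection_apply_mem (V j) v⟩
    rw [inner_sub_right, h1.unique h2, ← Submodule.inner_starProjection_left_eq_right,
      Submodule.starProjection_eq_self_iff.2 hu, sub_self]
  rw [htot, Submodule.mem_bot, sub_eq_zero] at hmem
  exact hmem.symm

end OrthogonalExpansion

/-! ### The contraction semigroup generated by `-A`. -/

section Semigroup

set_option linter.unusedSectionVars false

variable {H : Type*} [NormedAddCommGroup H] [InnerProductSpace ℝ H] [CompleteSpace H]
  {A : H →ₗ.[ℝ] H}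

lemma inner_apply_left_eq_right (hAd : Dense (A.domain : Set H)) (hA : IsSelfAdjoint A)
    (u w : A.domain) : inner ℝ (A u) (w : H) = inner ℝ (u : H) (A w) := by
  have h := LinearPMap.adjoint_isFormalAdjoint hAd
  rw [LinearPMap.isSelfAdjoint_def.1 hA] at h
  exact h u w

/-- Symmetry gives `(c - c') ⟨u, w⟩ = 0` for eigenvectors; orthogonality passes to closures because
orthogonal complements are closed. -/
lemma orthogonalFamily_eigenspace (hAd : Dense (A.domain : Set H)) (hA : IsSelfAdjoint A) :
    OrthogonalFamily ℝ (fun c => (eigenspace A c).topologicalClosure)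
      fun c => (eigenspace A c).topologicalClosure.subtypeₗᵢ := by
  refine OrthogonalFamily.of_pairwise fun c c' hcc' => ?_
  have h : eigenspace A c ⟂ eigenspace A c' := by
    rw [Submodule.isOrtho_iff_inner_eq]
    rintro u ⟨hu, hu'⟩ w ⟨hw, hw'⟩
    have h := inner_apply_left_eq_right hAd hA ⟨u, hu⟩ ⟨w, hw⟩
    rw [hu', hw', inner_smul_left, inner_smul_right] at h
    have h' : (c - c') * inner ℝ u w = 0 := by
      rw [sub_mul, sub_eq_zero]
      exact h
    exact (mul_eq_zero.1 h').resolve_left (sub_ne_zero.2 hcc')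
  have h1 : (eigenspace A c).topologicalClosure ⟂ eigenspace A c' :=
    Submodule.topologicalClosure_minimal _ h (Submodule.isClosed_orthogonal _)
  have h2 : (eigenspace A c').topologicalClosure ⟂ (eigenspace A c).topologicalClosure :=
    Submodule.topologicalClosure_minimal _ h1.symm (Submodule.isClosed_orthogonal _)
  exact h2.symm

lemma nonneg_of_eigenspace_ne_bot (hApos : IsPositive A) {c : ℝ} (hc : eigenspace A c ≠ ⊥) :
    0 ≤ c := by
  obtain ⟨v, ⟨hv, hAv⟩, hv0⟩ := Submodule.exists_mem_ne_zero_of_ne_bot hc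
  have h := hApos ⟨v, hv⟩
  rw [hAv, inner_smul_left, real_inner_self_eq_norm_sq] at h
  have : 0 < ‖v‖ ^ 2 := by positivity
  exact nonneg_of_mul_nonneg_left h this

/-- The spectral theorem for the compact symmetric operator `R = (A - μ)⁻¹`. An eigenvector of `R`
for `l ≠ 0` is one of `A` for `μ + l⁻¹`, and `R` is injective, so that `l = 0` contributes nothing.
-/
lemma iSup_eigenspace_orthogonal (hAd : Dense (A.domain : Set H)) (hA : IsSelfAdjoint A)
    (hAc : HasCompactResolvent A) :
    (⨆ c, (eigenspace A c).topologicalClosure)ᗮ = ⊥ := by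
  obtain ⟨μ, R, ⟨hR1, hR2⟩, hRc⟩ := hAc
  have hsymm : (R : H →ₗ[ℝ] H).IsSymmetric := by
    intro v w
    obtain ⟨hv, hv'⟩ := hR1 v
    obtain ⟨hw, hw'⟩ := hR1 w
    have h := inner_apply_left_eq_right hAd hA ⟨R v, hv⟩ ⟨R w, hw⟩
    simp only [ContinuousLinearMap.coe_coe]
    conv_lhs => rw [← hw']
    conv_rhs => rw [← hv']
    rw [inner_sub_right, inner_sub_left, ← h, inner_smul_left, inner_smul_right]
    simp
  have htop := ContinuousLinearMap.orthogonalComplement_iSup_eigenspaces_eq_bot hRc hsymm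
  rw [← htop, eq_comm]
  refine le_antisymm (htop.trans_le bot_le) (Submodule.orthogonal_le (iSup_le fun l => ?_))
  intro v hv
  rw [Module.End.mem_eigenspace_iff] at hv
  simp only [ContinuousLinearMap.coe_coe] at hv
  obtain ⟨hd, hd'⟩ := hR1 v
  rcases eq_or_ne l 0 with rfl | hl
  · have h0 : (⟨R v, hd⟩ : A.domain) = 0 := by
      ext
      simp [hv]
    rw [h0, hv] at hd'
    simp at hd'
    simp [← hd']
  · refine Submodule.mem_iSup_of_mem (μ + l⁻¹) (Submodule.le_topologicalClosure _ ?_)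
    have hvd : v ∈ A.domain := by
      have := A.domain.smul_mem l⁻¹ hd
      rwa [hv, smul_smul, inv_mul_cancel₀ hl, one_smul] at this
    refine ⟨hvd, ?_⟩
    have h1 : (⟨R v, hd⟩ : A.domain) = l • ⟨v, hvd⟩ := by
      ext
      simp [hv]
    rw [h1, A.map_smul, hv] at hd'
    have h2 : l⁻¹ • (l • A ⟨v, hvd⟩ - μ • l • v) = l⁻¹ • v := by rw [hd']
    rw [smul_sub, smul_smul, inv_mul_cancel₀ hl, one_smul, smul_comm μ l v, smul_smul,
      inv_mul_cancel₀ hl, one_smul, sub_eq_iff_eq_add] at h2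
    rw [h2, add_smul, add_comm]

/-- The properties of an unbounded operator that make `expNeg` a contraction semigroup. -/
structure HasNonnegSpectralResolution (A : H →ₗ.[ℝ] H) : Prop where
  orthogonal : OrthogonalFamily ℝ (fun c => (eigenspace A c).topologicalClosure)
      fun c => (eigenspace A c).topologicalClosure.subtypeₗᵢ
  total : (⨆ c, (eigenspace A c).topologicalClosure)ᗮ = ⊥
  nonneg : ∀ c, eigenspace A c ≠ ⊥ → 0 ≤ c

lemma HasNonnegSpectralResolution.abs_exp_le (h : HasNonnegSpectralResolution A) {t : ℝ}
    (ht : 0 ≤ t) (v : H) (c : ℝ) (hc : (eigenspace A c).topologicalClosure.starProjection v ≠ 0) :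
    |Real.exp (-(t * c))| ≤ 1 := by
  have : 0 ≤ c := by
    refine h.nonneg c fun hb => hc ?_
    have h1 := Submodule.starProjection_apply_mem (eigenspace A c).topologicalClosure v
    have h2 : (eigenspace A c).topologicalClosure = ⊥ := by
      rw [hb]; exact (Submodule.closed_of_finiteDimensional _).submodule_topologicalClosure_eq
    exact (Submodule.mem_bot ℝ).1 (h2.le h1)
  rw [abs_of_pos (Real.exp_pos _)]
  exact Real.exp_le_one_iff.2 (neg_nonpos.2 (mul_nonneg ht this))

lemma HasNonnegSpectralResolution.expNeg_zero (h : HasNonnegSpectralResolution A) (v : H) :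
    expNeg A 0 v = v := by
  simpa [expNeg] using tsum_starProjection_of_total h.orthogonal h.total v

lemma HasNonnegSpectralResolution.expNeg_sub (h : HasNonnegSpectralResolution A) {t : ℝ}
    (ht : 0 ≤ t) (v w : H) : expNeg A t (v - w) = expNeg A t v - expNeg A t w := by
  unfold expNeg
  rw [← (summable_smul_starProjection h.orthogonal (h.abs_exp_le ht v)).tsum_sub
    (summable_smul_starProjection h.orthogonal (h.abs_exp_le ht w))]
  simp [smul_sub]

/-- Parseval's identity for both sides, with factors `e^{-tc}` at most 1 on the nonzero components.
-/
lemma HasNonnegSpectralResolution.norm_expNeg_le (h : HasNonnegSpectralResolution A) {t : ℝ}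
    (ht : 0 ≤ t) (v : H) : ‖expNeg A t v‖ ≤ ‖v‖ := by
  have h1 := norm_tsum_smul_starProjection_sq h.orthogonal (h.abs_exp_le ht v)
  have h2 := norm_tsum_smul_starProjection_sq h.orthogonal (a := fun _ => 1) (v := v) (C := 1)
    (by simp)
  simp only [one_smul] at h2
  rw [tsum_starProjection_of_total h.orthogonal h.total v] at h2
  refine (sq_le_sq₀ (norm_nonneg _) (norm_nonneg _)).1 ?_
  unfold expNeg
  rw [h1, h2]
  refine (summable_mul_norm_starProjection_sq h.orthogonal (h.abs_exp_le ht v)).tsum_le_tsum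
    (fun c => ?_) (summable_mul_norm_starProjection_sq h.orthogonal (C := 1) (by simp))
  by_cases hc : (eigenspace A c).topologicalClosure.starProjection v = 0
  · simp [hc]
  · refine mul_le_mul_of_nonneg_right ?_ (by positivity)
    have := h.abs_exp_le ht v c hc
    exact sq_le_sq' (by linarith [neg_le_of_abs_le this]) (le_of_abs_le this)

/-- By Parseval the squared distance is a series dominated by `4 ‖P_c v‖²`, and each term tends to
zero. -/
lemma HasNonnegSpectralResolution.continuousOn_expNeg (h : HasNonnegSpectralResolution A)
    (v : H) : ContinuousOn (fun t => expNeg A t v) (Ici 0) := by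
  intro t₀ ht₀
  rw [ContinuousWithinAt, tendsto_iff_norm_sub_tendsto_zero]
  have hb : ∀ t ∈ Ici (0 : ℝ), ∀ c, (eigenspace A c).topologicalClosure.starProjection v ≠ 0 →
      |Real.exp (-(t * c)) - Real.exp (-(t₀ * c))| ≤ 2 := by
    intro t ht c hc
    refine (abs_sub _ _).trans ?_
    linarith [h.abs_exp_le ht v c hc, h.abs_exp_le ht₀ v c hc]
  have key : ∀ t ∈ Ici (0 : ℝ), ‖expNeg A t v - expNeg A t₀ v‖ ^ 2 =
      ∑' c : ℝ, (Real.exp (-(t * c)) - Real.exp (-(t₀ * c))) ^ 2 *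
        ‖(eigenspace A c).topologicalClosure.starProjection v‖ ^ 2 := by
    intro t ht
    rw [← norm_tsum_smul_starProjection_sq h.orthogonal (hb t ht)]
    unfold expNeg
    rw [← (summable_smul_starProjection h.orthogonal (h.abs_exp_le ht v)).tsum_sub
      (summable_smul_starProjection h.orthogonal (h.abs_exp_le ht₀ v))]
    simp [sub_smul]
  have hlim : Tendsto (fun t => ‖expNeg A t v - expNeg A t₀ v‖ ^ 2) (𝓝[Ici 0] t₀) (𝓝 0) := by
    suffices Tendsto (fun t => ‖expNeg A t v - expNeg A t₀ v‖ ^ 2) (𝓝[Ici 0] t₀)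
        (𝓝 (∑' _ : ℝ, (0 : ℝ))) by simpa only [tsum_zero] using this
    refine Tendsto.congr' (f₁ := fun t => ∑' c : ℝ, (Real.exp (-(t * c)) -
      Real.exp (-(t₀ * c))) ^ 2 * ‖(eigenspace A c).topologicalClosure.starProjection v‖ ^ 2) ?_ ?_
    · filter_upwards [self_mem_nhdsWithin] with t ht using (key t ht).symm
    · refine tendsto_tsum_of_dominated_convergence
        ((summable_norm_starProjection_sq h.orthogonal v).mul_left (2 ^ 2)) (fun c => ?_) ?_
      · have : Continuous fun t : ℝ => (Real.exp (-(t * c)) - Real.exp (-(t₀ * c))) ^ 2 *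
            ‖(eigenspace A c).topologicalClosure.starProjection v‖ ^ 2 := by fun_prop
        have := (this.tendsto t₀).mono_left (nhdsWithin_le_nhds (s := Ici 0))
        simpa using this
      · filter_upwards [self_mem_nhdsWithin] with t ht c
        by_cases hc : (eigenspace A c).topologicalClosure.starProjection v = 0
        · simp [hc]
        · rw [norm_mul, norm_pow, norm_pow, norm_norm, Real.norm_eq_abs]
          gcongr
          exact hb t ht c hc
  have := hlim.sqrt
  simpa [Real.sqrt_sq (norm_nonneg _)] using this

lemma hasNonnegSpectralResolution (hAd : Dense (A.domain : Set H)) (hA : IsSelfAdjoint A)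
    (hApos : IsPositive A) (hAc : HasCompactResolvent A) : HasNonnegSpectralResolution A :=
  ⟨orthogonalFamily_eigenspace hAd hA, iSup_eigenspace_orthogonal hAd hA hAc,
    fun _ hc => nonneg_of_eigenspace_ne_bot hApos hc⟩

/-- `(t, v) ↦ e^{-tA} v`, extended by the identity to negative times, is continuous. -/
lemma HasNonnegSpectralResolution.continuous_expNeg (h : HasNonnegSpectralResolution A) :
    Continuous fun p : ℝ × H => expNeg A (max p.1 0) p.2 := by
  rw [continuous_iff_continuousAt]
  rintro ⟨t, v⟩
  have h1 : Continuous fun s : ℝ => expNeg A (max s 0) v :=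
    (h.continuousOn_expNeg v).comp_continuous (by fun_prop) fun s => mem_Ici.2 (le_max_right _ _)
  rw [ContinuousAt, tendsto_iff_norm_sub_tendsto_zero]
  have h2 : Tendsto (fun p : ℝ × H => ‖p.2 - v‖ +
      ‖expNeg A (max p.1 0) v - expNeg A (max t 0) v‖) (𝓝 (t, v)) (𝓝 0) := by
    have : Continuous fun p : ℝ × H => ‖p.2 - v‖ +
      ‖expNeg A (max p.1 0) v - expNeg A (max t 0) v‖ :=
      (continuous_snd.sub continuous_const).norm.add
        ((h1.comp continuous_fst).sub continuous_const).norm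
    simpa using this.tendsto (t, v)
  refine squeeze_zero (fun _ => norm_nonneg _) (fun p => ?_) h2
  refine (norm_sub_le_norm_sub_add_norm_sub _ (expNeg A (max p.1 0) v) _).trans ?_
  rw [← h.expNeg_sub (le_max_right _ _)]
  gcongr
  exact h.norm_expNeg_le (le_max_right _ _) _

end Semigroup

/-! ### Abstract delay equations: existence by steps of length `δ`. -/

section DelayEquation

set_option linter.unusedSectionVars false

variable {H : Type*} [NormedAddCommGroup H] [NormedSpace ℝ H]

/-- A strongly continuous family of contractions starting at the identity. -/
structure IsContractionFamily (S : ℝ → H → H) : Prop where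
  continuous : Continuous fun p : ℝ × H => S p.1 p.2
  zero : ∀ v, S 0 v = v
  norm_sub_le : ∀ t v w, ‖S t v - S t w‖ ≤ ‖v - w‖

/-- The segment `w_t(θ) = w(t + θ)`, `θ ∈ [-r, 0]`, of a function on the line. -/
def history (r : ℝ) (w : C(ℝ, H)) (t : ℝ) : C(Icc (-r) 0, H) where
  toFun θ := w (t + θ)
  continuous_toFun := by fun_prop

/-- The right-hand side of the variation of constants formula. -/
noncomputable def duhamel {r : ℝ} (S : ℝ → H → H) (F : C(Icc (-r) 0, H) → H) (v : H)
    (w : C(ℝ, H)) (t : ℝ) : H :=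
  S t v + ∫ s in (0 : ℝ)..t, S (t - s) (F (history r w s))

/-- `w` is a mild solution on `[-r, T]` with initial value `φ`; its values outside `[-r, T]` do not
matter. -/
structure IsMildOn {r : ℝ} (hr : 0 < r) (S : ℝ → H → H) (F : C(Icc (-r) 0, H) → H)
    (φ : C(Icc (-r) 0, H)) (T : ℝ) (w : C(ℝ, H)) : Prop where
  initial : ∀ θ : Icc (-r) 0, w θ = φ θ
  eq : ∀ t ∈ Icc 0 T, w t = duhamel S F (φ ⟨0, neg_nonpos.2 hr.le, le_rfl⟩) w t

/-- `F φ = G φ φ` with `G` Lipschitz in the second argument and such that `G φ` depends only on the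
restriction of `φ` to `[-r, -δ]`. -/
structure IsIgnoringFactorization {r : ℝ} (F : C(Icc (-r) 0, H) → H)
    (G : C(Icc (-r) 0, H) → C(Icc (-r) 0, H) → H) (ℓ : C(Icc (-r) 0, H) → ℝ) (δ : ℝ) : Prop where
  continuous : Continuous fun p : C(Icc (-r) 0, H) × C(Icc (-r) 0, H) => G p.1 p.2
  diag : ∀ φ, F φ = G φ φ
  lipschitz : ∀ ψ χ χ', ‖G ψ χ - G ψ χ'‖ ≤ ℓ ψ * ‖χ - χ'‖
  continuous_lip : Continuous ℓ
  pos : 0 < δ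
  ignoring : ∀ φ ψ : C(Icc (-r) 0, H), (∀ θ : Icc (-r) 0, (θ : ℝ) ≤ -δ → φ θ = ψ θ) → G φ = G ψ

/-- Precomposition with the projection of the line onto `[-r, a]`. -/
noncomputable def clip {r : ℝ} (hr : 0 < r) {a : ℝ} (ha : 0 ≤ a) (w : C(ℝ, H)) : C(ℝ, H) where
  toFun t := w (projIcc (-r) a ((neg_nonpos.2 hr.le).trans ha) t)
  continuous_toFun := w.continuous.comp (continuous_subtype_val.comp continuous_projIcc)

variable {r : ℝ} {hr : 0 < r} {S : ℝ → H → H} {F : C(Icc (-r) 0, H) → H}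
  {G : C(Icc (-r) 0, H) → C(Icc (-r) 0, H) → H} {ℓ : C(Icc (-r) 0, H) → ℝ} {δ : ℝ}

@[simp] lemma history_apply (w : C(ℝ, H)) (t : ℝ) (θ : Icc (-r) 0) :
    history r w t θ = w (t + θ) := rfl

lemma continuous_history : Continuous fun p : C(ℝ, H) × ℝ => history r p.1 p.2 := by
  refine ContinuousMap.continuous_of_continuous_uncurry _ ?_
  change Continuous fun q : (C(ℝ, H) × ℝ) × Icc (-r) 0 => q.1.1 (q.1.2 + q.2)
  fun_prop

lemma IsIgnoringFactorization.continuous_diag (hF : IsIgnoringFactorization F G ℓ δ) :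
    Continuous F := by
  have : F = fun φ => G φ φ := funext hF.diag
  rw [this]
  exact hF.continuous.comp (continuous_id.prodMk continuous_id)

lemma continuous_duhamel_integrand (hS : IsContractionFamily S) (hF : Continuous F)
    (w : C(ℝ, H)) : Continuous fun p : ℝ × ℝ => S (p.1 - p.2) (F (history r w p.2)) := by
  have h : Continuous fun s => F (history r w s) :=
    hF.comp (continuous_history.comp (continuous_const.prodMk continuous_id))
  exact hS.continuous.comp ((continuous_fst.sub continuous_snd).prodMk (h.comp continuous_snd))

lemma continuous_duhamel (hS : IsContractionFamily S) (hF : Continuous F) (v : H) (w : C(ℝ, H)) :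
    Continuous (duhamel S F v w) := by
  refine Continuous.add (hS.continuous.comp (continuous_id.prodMk continuous_const)) ?_
  exact intervalIntegral.continuous_parametric_intervalIntegral_of_continuous
    (continuous_duhamel_integrand hS hF w) continuous_id

lemma history_congr {w w' : C(ℝ, H)} {T : ℝ} (h : ∀ t ∈ Icc (-r) T, w t = w' t) {s : ℝ}
    (hs : s ∈ Icc 0 T) : history r w s = history r w' s := by
  ext θ
  exact h _ ⟨by linarith [θ.2.1, hs.1], by linarith [θ.2.2, hs.2]⟩

lemma duhamel_congr {w w' : C(ℝ, H)} {T : ℝ} (h : ∀ t ∈ Icc (-r) T, w t = w' t) (v : H) {t : ℝ}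
    (ht : t ∈ Icc 0 T) : duhamel S F v w t = duhamel S F v w' t := by
  unfold duhamel
  congr 1
  refine intervalIntegral.integral_congr fun s hs => ?_
  rw [uIcc_of_le ht.1] at hs
  simp only [history_congr h ⟨hs.1, hs.2.trans ht.2⟩]

lemma IsMildOn.congr {φ : C(Icc (-r) 0, H)} {T : ℝ} {w w' : C(ℝ, H)}
    (hw : IsMildOn hr S F φ T w) (hT : 0 ≤ T) (h : ∀ t ∈ Icc (-r) T, w t = w' t) :
    IsMildOn hr S F φ T w' where
  initial θ := by rw [← h θ ⟨θ.2.1, θ.2.2.trans hT⟩, hw.initial]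
  eq t ht := by
    rw [← h t ⟨by linarith [ht.1], ht.2⟩, hw.eq t ht, duhamel_congr h _ ht]

lemma IsMildOn.mono {φ : C(Icc (-r) 0, H)} {T T' : ℝ} {w : C(ℝ, H)}
    (hw : IsMildOn hr S F φ T w) (h : T' ≤ T) : IsMildOn hr S F φ T' w :=
  ⟨hw.initial, fun t ht => hw.eq t ⟨ht.1, ht.2.trans h⟩⟩

/-- The basic estimate for weighted norms: integrating `e^{as}` gains a factor `1 / a`, which
becomes small for large `a`. It serves both the contraction and the Gronwall argument. -/
lemma norm_duhamel_sub_le (hS : IsContractionFamily S) (hF : Continuous F) {v v' : H}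
    {w w' : C(ℝ, H)} {t a C ε : ℝ} (ht : 0 ≤ t) (ha : 0 < a) (hC : 0 ≤ C)
    (h : ∀ s ∈ Icc 0 t, ‖F (history r w s) - F (history r w' s)‖ ≤ C * Real.exp (a * s) + ε) :
    ‖duhamel S F v w t - duhamel S F v' w' t‖ ≤
      ‖v - v'‖ + (C * Real.exp (a * t) / a + ε * t) := by
  have hc : ∀ w : C(ℝ, H), Continuous fun s => S (t - s) (F (history r w s)) := fun w =>
    (continuous_duhamel_integrand hS hF w).comp (continuous_const.prodMk continuous_id)
  have hint : ∀ w : C(ℝ, H),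
      IntervalIntegrable (fun s => S (t - s) (F (history r w s))) volume 0 t :=
    fun w => (hc w).intervalIntegrable _ _
  have hsub : duhamel S F v w t - duhamel S F v' w' t = (S t v - S t v') +
      ∫ s in (0 : ℝ)..t, (S (t - s) (F (history r w s)) - S (t - s) (F (history r w' s))) := by
    rw [intervalIntegral.integral_sub (hint w) (hint w')]
    unfold duhamel
    abel
  rw [hsub]
  refine (norm_add_le _ _).trans (add_le_add (hS.norm_sub_le _ _ _) ?_)
  have hbound : Continuous fun s : ℝ => C * Real.exp (a * s) + ε := by fun_prop
  refine (intervalIntegral.norm_integral_le_of_norm_le (g := fun s => C * Real.exp (a * s) + ε) ht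
    (Eventually.of_forall fun s hs => (hS.norm_sub_le _ _ _).trans (h s ⟨hs.1.le, hs.2⟩))
    (hbound.intervalIntegrable _ _)).trans ?_
  have hderiv : ∀ s ∈ uIcc 0 t, HasDerivAt (fun s => C * Real.exp (a * s) / a + ε * s)
      (C * Real.exp (a * s) + ε) s := by
    intro s _
    have h1 : HasDerivAt (fun s => Real.exp (a * s)) (Real.exp (a * s) * a) s := by
      simpa using ((hasDerivAt_id s).const_mul a).exp
    have h2 := ((h1.const_mul C).div_const a).add ((hasDerivAt_id s).const_mul ε)
    refine h2.congr_deriv ?_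
    field_simp
  rw [intervalIntegral.integral_eq_sub_of_hasDerivAt hderiv (hbound.intervalIntegrable _ _)]
  have : 0 ≤ C * Real.exp (a * 0) / a := by positivity
  linarith

lemma clip_apply {a : ℝ} {ha : 0 ≤ a} {w : C(ℝ, H)} {t : ℝ} (ht : t ∈ Icc (-r) a) :
    clip hr ha w t = w t := by
  simp [clip, projIcc_of_mem _ ht]

lemma clip_congr {a : ℝ} {ha : 0 ≤ a} {w w' : C(ℝ, H)} (h : ∀ t ∈ Icc (-r) a, w t = w' t) :
    clip hr ha w = clip hr ha w' := by
  refine ContinuousMap.ext fun t => ?_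
  exact h _ (projIcc (-r) a _ t).2

/-- On `[0, a + δ]` the first argument of the factorization is determined by `w` on `[-r, a]`. -/
lemma IsIgnoringFactorization.apply_history (hF : IsIgnoringFactorization F G ℓ δ) (w : C(ℝ, H))
    {a t : ℝ} (ha : 0 ≤ a) (ht : t ∈ Icc 0 (a + δ)) :
    F (history r w t) = G (history r (clip hr ha w) t) (history r w t) := by
  rw [hF.diag]
  refine congrFun (hF.ignoring (history r w t) (history r (clip hr ha w) t) fun θ hθ => ?_) _
  rw [history_apply, history_apply,
    clip_apply ⟨by linarith [θ.2.1, ht.1], by linarith [ht.2]⟩]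

/-- Up to time `a + δ` the first argument of `G` is fixed by the given solution on `[-r, a]`, so the
right-hand side is Lipschitz with one constant `K`, and a weighted fixed point argument covers the
whole step, however large `K` is. -/
lemma IsIgnoringFactorization.exists_extension [CompleteSpace H] (hS : IsContractionFamily S)
    (hF : IsIgnoringFactorization F G ℓ δ) {φ : C(Icc (-r) 0, H)} {a : ℝ} (ha : 0 ≤ a)
    {w : C(ℝ, H)} (hw : IsMildOn hr S F φ a w) :
    ∃ w', IsMildOn hr S F φ (a + δ) w' := by
  set b := a + δ with hb
  have hab : a ≤ b := by linarith [hF.pos]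
  set φ₀ := φ ⟨0, neg_nonpos.2 hr.le, le_rfl⟩ with hφ₀
  obtain ⟨K, hK0, hK⟩ : ∃ K : ℝ, 0 ≤ K ∧ ∀ t ∈ Icc 0 b, ℓ (history r (clip hr ha w) t) ≤ K := by
    have hcont : Continuous fun t => ℓ (history r (clip hr ha w) t) :=
      hF.continuous_lip.comp (continuous_history.comp (continuous_const.prodMk continuous_id))
    obtain ⟨K, hK⟩ := (isCompact_Icc (a := (0 : ℝ)) (b := b)).bddAbove_image hcont.continuousOn
    exact ⟨max K 0, le_max_right _ _, fun t ht => (hK ⟨t, ht, rfl⟩).trans (le_max_left _ _)⟩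
  have hlip : ∀ w₁ w₂ : C(ℝ, H), (∀ t ≤ a, w₁ t = w t) → (∀ t ≤ a, w₂ t = w t) →
      ∀ t ∈ Icc 0 b, ‖F (history r w₁ t) - F (history r w₂ t)‖ ≤
        K * ‖history r w₁ t - history r w₂ t‖ := by
    intro w₁ w₂ h₁ h₂ t ht
    rw [hF.apply_history (hr := hr) w₁ ha ht, hF.apply_history (hr := hr) w₂ ha ht,
      clip_congr fun t ht => h₁ t ht.2, clip_congr fun t ht => h₂ t ht.2]
    exact (hF.lipschitz _ _ _).trans (mul_le_mul_of_nonneg_right (hK t ht) (norm_nonneg _))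
  -- Chosen so that the contraction factor `2 * K / c` is at most `1 / 2`; the `+ 1` keeps `c`
  -- positive when `K = 0`.
  set c := 4 * K + 1 with hc
  have hc0 : 0 < c := by positivity
  let p : ℝ → Icc a b := projIcc a b hab
  have hp : Continuous p := continuous_projIcc
  have hpa : ∀ t ≤ a, p t = ⟨a, le_rfl, hab⟩ := fun t ht => projIcc_of_le_left _ ht
  -- The unknown `z` is the solution on `[a, b]` multiplied by `e^{-ct}`, so that the plain sup norm
  -- of `z` is the weighted norm. Subtracting the value at `a` makes `e z` continue `w` continuously
  -- for every `z`. At the fixed point `e^{ca} z(a) = w a`, and this correction leaves just the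
  -- rescaled `z`.
  let e : C(Icc a b, H) → C(ℝ, H) := fun z =>
    ⟨fun t => w (min t a) + (Real.exp (c * p t) • z (p t) - Real.exp (c * a) • z (p a)), by
      fun_prop⟩
  have he : ∀ z t, t ≤ a → e z t = w t := by
    intro z t ht
    change w (min t a) + (Real.exp (c * p t) • z (p t) - Real.exp (c * a) • z (p a)) = w t
    rw [hpa t ht, hpa a le_rfl, min_eq_left ht]
    simp
  have hediff : ∀ z z' s, s ∈ Icc 0 b → ∀ τ ≤ s,
      ‖e z τ - e z' τ‖ ≤ 2 * ‖z - z'‖ * Real.exp (c * s) := by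
    intro z z' s hs τ hτ
    rcases le_total s a with hsa | hsa
    · rw [he z τ (hτ.trans hsa), he z' τ (hτ.trans hsa), sub_self, norm_zero]
      positivity
    · have h1 : e z τ - e z' τ = Real.exp (c * p τ) • (z - z') (p τ) -
          Real.exp (c * a) • (z - z') (p a) := by
        change (w (min τ a) + (Real.exp (c * p τ) • z (p τ) - Real.exp (c * a) • z (p a))) -
          (w (min τ a) + (Real.exp (c * p τ) • z' (p τ) - Real.exp (c * a) • z' (p a))) = _
        simp only [ContinuousMap.sub_apply, smul_sub]
        abel
      have h2 : (p τ : ℝ) ≤ s := by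
        change max a (min b τ) ≤ s
        exact max_le hsa ((min_le_right _ _).trans hτ)
      have h3 : ∀ q : Icc a b, ∀ x ≤ s,
          ‖Real.exp (c * x) • (z - z') q‖ ≤ ‖z - z'‖ * Real.exp (c * s) := by
        intro q x hx
        rw [norm_smul, Real.norm_eq_abs, abs_of_pos (Real.exp_pos _), mul_comm]
        gcongr
        exact (z - z').norm_coe_le_norm q
      rw [h1]
      refine (norm_sub_le _ _).trans ?_
      linarith [h3 (p τ) _ h2, h3 (p a) a hsa]
  let Ψ : C(Icc a b, H) → C(Icc a b, H) := fun z =>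
    ⟨fun t => Real.exp (-(c * t)) • duhamel S F φ₀ (e z) t, by
      have := continuous_duhamel hS hF.continuous_diag φ₀ (e z)
      fun_prop⟩
  have hΨ : ContractingWith (1 / 2) Ψ := by
    refine ⟨by norm_num, LipschitzWith.of_dist_le_mul fun z z' => ?_⟩
    rw [ContinuousMap.dist_le (by positivity)]
    intro t
    have ht0 : 0 ≤ (t : ℝ) := ha.trans t.2.1
    have h1 := norm_duhamel_sub_le hS hF.continuous_diag (v := φ₀) (v' := φ₀) (w := e z)
      (w' := e z') (t := t) (a := c) (C := K * (2 * ‖z - z'‖)) (ε := 0) ht0 hc0 (by positivity) (by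
        intro s hs
        have hs' : s ∈ Icc 0 b := ⟨hs.1, hs.2.trans t.2.2⟩
        refine (hlip _ _ (he z) (he z') s hs').trans ?_
        rw [add_zero, mul_assoc]
        gcongr
        rw [ContinuousMap.norm_le _ (by positivity)]
        intro θ
        exact hediff z z' s hs' _ (by linarith [θ.2.2]))
    rw [dist_eq_norm, dist_eq_norm]
    change ‖Real.exp (-(c * t)) • duhamel S F φ₀ (e z) t -
      Real.exp (-(c * t)) • duhamel S F φ₀ (e z') t‖ ≤ _
    rw [← smul_sub, norm_smul, Real.norm_eq_abs, abs_of_pos (Real.exp_pos _)]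
    refine (mul_le_mul_of_nonneg_left h1 (Real.exp_pos _).le).trans ?_
    have h2 : Real.exp (-(c * t)) * (‖φ₀ - φ₀‖ +
        (K * (2 * ‖z - z'‖) * Real.exp (c * t) / c + 0 * t)) =
        (2 * K / c) * ‖z - z'‖ * (Real.exp (-(c * t)) * Real.exp (c * t)) := by
      rw [sub_self, norm_zero]
      ring
    rw [h2, ← Real.exp_add, neg_add_cancel, Real.exp_zero, mul_one]
    refine mul_le_mul_of_nonneg_right ?_ (norm_nonneg _)
    rw [div_le_iff₀ hc0]
    push_cast
    linarith
  have : Nonempty C(Icc a b, H) := ⟨0⟩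
  obtain ⟨z, hz⟩ : ∃ z, Ψ z = z := ⟨_, hΨ.fixedPoint_isFixedPt⟩
  have hz' : ∀ t : Icc a b, Real.exp (c * t) • z t = duhamel S F φ₀ (e z) t := by
    intro t
    have h1 : Real.exp (-(c * t)) • duhamel S F φ₀ (e z) t = z t := congrArg (fun q => q t) hz
    rw [← h1, smul_smul, ← Real.exp_add, add_neg_cancel, Real.exp_zero, one_smul]
  have hza : Real.exp (c * a) • z (p a) = w a := by
    rw [hpa a le_rfl]
    refine (hz' ⟨a, le_rfl, hab⟩).trans ?_
    rw [hw.eq a ⟨ha, le_rfl⟩]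
    exact duhamel_congr (fun t ht => he z t ht.2) _ ⟨ha, le_rfl⟩
  refine ⟨e z, fun θ => ?_, fun t ht => ?_⟩
  · rw [he z θ (θ.2.2.trans ha), hw.initial]
  · rcases le_total t a with hta | hta
    · rw [he z t hta, hw.eq t ⟨ht.1, hta⟩]
      exact (duhamel_congr (fun t ht => he z t ht.2) _ ⟨ht.1, hta⟩).symm
    · have hpt : p t = ⟨t, hta, ht.2⟩ := projIcc_of_mem _ _
      change w (min t a) + (Real.exp (c * p t) • z (p t) - Real.exp (c * a) • z (p a)) = _
      rw [hza, min_eq_right hta, hpt, add_sub_cancel]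
      exact hz' ⟨t, hta, ht.2⟩

/-- Induction on the number of steps. It starts at time `0`, where the constant extension of `φ`
already qualifies because the integral is empty. -/
lemma IsIgnoringFactorization.exists_isMildOn [CompleteSpace H] (hS : IsContractionFamily S)
    (hF : IsIgnoringFactorization F G ℓ δ) (φ : C(Icc (-r) 0, H)) (T : ℝ) :
    ∃ w, IsMildOn hr S F φ T w := by
  have key : ∀ N : ℕ, ∃ w, IsMildOn hr S F φ (N * δ) w := by
    intro N
    induction N with
    | zero =>
      refine ⟨⟨fun t => φ (projIcc (-r) 0 (neg_nonpos.2 hr.le) t),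
        φ.continuous.comp continuous_projIcc⟩, fun θ => ?_, fun t ht => ?_⟩
      · simp
      · have ht0 : t = 0 := le_antisymm (by simpa using ht.2) ht.1
        subst ht0
        simp only [duhamel, intervalIntegral.integral_same, add_zero, hS.zero,
          ContinuousMap.coe_mk]
        rw [projIcc_right]
    | succ N ih =>
      obtain ⟨w, hw⟩ := ih
      have := hF.exists_extension hS (by have := hF.pos; positivity) hw
      push_cast
      rwa [add_mul, one_mul]
  obtain ⟨N, hN⟩ := exists_nat_ge (T / δ)
  obtain ⟨w, hw⟩ := key N
  exact ⟨w, hw.mono ((div_le_iff₀ hF.pos).1 hN)⟩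

end DelayEquation

/-! ### Continuous dependence, uniqueness and global solutions of abstract delay equations. -/

section DelayEquationDependence

set_option linter.unusedSectionVars false

variable {H : Type*} [NormedAddCommGroup H] [NormedSpace ℝ H]
  {r : ℝ} {hr : 0 < r} {S : ℝ → H → H} {F : C(Icc (-r) 0, H) → H}
  {G : C(Icc (-r) 0, H) → C(Icc (-r) 0, H) → H} {ℓ : C(Icc (-r) 0, H) → ℝ} {δ : ℝ}

/-- A Gronwall estimate for two mild solutions. -/
lemma IsMildOn.norm_sub_le (hS : IsContractionFamily S) (hF : Continuous F)
    {φ φ' : C(Icc (-r) 0, H)} {b : ℝ} (hb : 0 ≤ b) {w w' : C(ℝ, H)}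
    (hw : IsMildOn hr S F φ b w) (hw' : IsMildOn hr S F φ' b w') {K ε : ℝ} (hK : 0 ≤ K)
    (hφ : ‖φ - φ'‖ ≤ ε)
    (h : ∀ s ∈ Icc 0 b, ‖F (history r w s) - F (history r w' s)‖ ≤
      K * ‖history r w s - history r w' s‖ + ε) :
    ∀ t ∈ Icc (-r) b, ‖w t - w' t‖ ≤ 2 * (ε * (1 + b) * Real.exp ((2 * K + 1) * r)) *
      Real.exp ((2 * K + 1) * b) := by
  have hε : 0 ≤ ε := (norm_nonneg _).trans hφ
  -- With this weight `K / c ≤ 1 / 2`, so half of the weighted maximum `m` is absorbed into the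
  -- left-hand side.
  set c := 2 * K + 1 with hc
  have hc0 : 0 < c := by positivity
  have hrb : -r ≤ b := by linarith
  have hcont : Continuous fun t => ‖w t - w' t‖ * Real.exp (-(c * t)) := by fun_prop
  obtain ⟨τ, hτ, hmax⟩ := isCompact_Icc.exists_isMaxOn (nonempty_Icc.2 hrb) hcont.continuousOn
  set m := ‖w τ - w' τ‖ * Real.exp (-(c * τ)) with hm
  have hm0 : 0 ≤ m := by positivity
  have hwm : ∀ t ∈ Icc (-r) b, ‖w t - w' t‖ ≤ m * Real.exp (c * t) := by
    intro t ht
    have h1 : ‖w t - w' t‖ * Real.exp (-(c * t)) ≤ m := hmax ht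
    rw [Real.exp_neg, ← div_eq_mul_inv, div_le_iff₀ (Real.exp_pos _)] at h1
    exact h1
  have hhist : ∀ s ∈ Icc 0 b, ‖history r w s - history r w' s‖ ≤ m * Real.exp (c * s) := by
    intro s hs
    rw [ContinuousMap.norm_le _ (by positivity)]
    intro θ
    refine (hwm (s + θ) ⟨by linarith [θ.2.1, hs.1], by linarith [θ.2.2, hs.2]⟩).trans ?_
    gcongr
    linarith [θ.2.2]
  have hall : ∀ t ∈ Icc (-r) b, ‖w t - w' t‖ ≤ ε * (1 + b) + m / 2 * Real.exp (c * t) := by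
    intro t ht
    rcases le_total 0 t with h0 | h0
    · rw [hw.eq t ⟨h0, ht.2⟩, hw'.eq t ⟨h0, ht.2⟩]
      refine (norm_duhamel_sub_le hS hF (C := K * m) (ε := ε) h0 hc0 (by positivity) ?_).trans ?_
      · intro s hs
        refine (h s ⟨hs.1, hs.2.trans ht.2⟩).trans ?_
        rw [mul_assoc]
        gcongr
        exact hhist s ⟨hs.1, hs.2.trans ht.2⟩
      · have h1 : ‖φ ⟨0, neg_nonpos.2 hr.le, le_rfl⟩ - φ' ⟨0, neg_nonpos.2 hr.le, le_rfl⟩‖ ≤ ε :=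
          ((φ - φ').norm_coe_le_norm _).trans hφ
        have h2 : ε * t ≤ ε * b := mul_le_mul_of_nonneg_left ht.2 hε
        have h3 : K * m * Real.exp (c * t) / c ≤ m / 2 * Real.exp (c * t) := by
          rw [div_le_iff₀ hc0, hc]
          have : 0 ≤ m * Real.exp (c * t) := by positivity
          nlinarith
        linarith
    · have h1 : w t - w' t = (φ - φ') ⟨t, ht.1, h0⟩ := by
        rw [ContinuousMap.sub_apply, ← hw.initial, ← hw'.initial]
      rw [h1]
      refine (((φ - φ').norm_coe_le_norm _).trans hφ).trans ?_
      have : 0 ≤ m / 2 * Real.exp (c * t) := by positivity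
      nlinarith
  -- The bound is read off at the maximum point `τ`, where `e^{-cτ} ≤ e^{cr}` since `τ ≥ -r`.
  have hm1 : m ≤ 2 * (ε * (1 + b) * Real.exp (c * r)) := by
    have h1 : m ≤ (ε * (1 + b) + m / 2 * Real.exp (c * τ)) * Real.exp (-(c * τ)) := by
      rw [hm]
      exact mul_le_mul_of_nonneg_right (hall τ hτ) (Real.exp_pos _).le
    rw [add_mul, mul_assoc (m / 2), ← Real.exp_add, add_neg_cancel, Real.exp_zero, mul_one] at h1
    have h2 : ε * (1 + b) * Real.exp (-(c * τ)) ≤ ε * (1 + b) * Real.exp (c * r) := by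
      gcongr
      nlinarith [hτ.1]
    linarith
  intro t ht
  refine (hwm t ht).trans ?_
  gcongr
  exact ht.2

lemma tendsto_clip {a : ℝ} {ha : 0 ≤ a} {ws : ℕ → C(ℝ, H)} {w : C(ℝ, H)}
    (h : ∀ ε > 0, ∀ᶠ n in atTop, ∀ t ∈ Icc (-r) a, ‖ws n t - w t‖ < ε) :
    Tendsto (fun n => clip hr ha (ws n)) atTop (𝓝 (clip hr ha w)) := by
  rw [ContinuousMap.tendsto_iff_forall_isCompact_tendstoUniformlyOn]
  intro K _
  rw [Metric.tendstoUniformlyOn_iff]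
  intro ε hε
  filter_upwards [h ε hε] with n hn t _
  rw [dist_comm, dist_eq_norm]
  exact hn _ (projIcc (-r) a _ t).2

/-- Clipping at `a` retains exactly what the first argument of `G` sees up to time `a + δ`. The
difference of the right-hand sides thus splits into a Lipschitz term in the second argument and an
error from the first argument that tends to zero uniformly; Gronwall does the rest. -/
lemma IsIgnoringFactorization.tendsto_clip_extension (hS : IsContractionFamily S)
    (hF : IsIgnoringFactorization F G ℓ δ) {φs : ℕ → C(Icc (-r) 0, H)} {φ : C(Icc (-r) 0, H)}
    (hφ : Tendsto φs atTop (𝓝 φ)) {a b : ℝ} (ha : 0 ≤ a) (hb : 0 ≤ b) (hba : b ≤ a + δ)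
    {ws : ℕ → C(ℝ, H)} {w : C(ℝ, H)} (hws : ∀ n, IsMildOn hr S F (φs n) b (ws n))
    (hw : IsMildOn hr S F φ b w)
    (h : Tendsto (fun n => clip hr ha (ws n)) atTop (𝓝 (clip hr ha w))) :
    Tendsto (fun n => clip hr hb (ws n)) atTop (𝓝 (clip hr hb w)) := by
  have hH : ∀ w : C(ℝ, H), Continuous fun s => history r w s := fun w =>
    continuous_history.comp (continuous_const.prodMk continuous_id)
  -- Freezing the second argument at the limit solution turns joint continuity of `G` into
  -- continuity for the compact-open topology, hence into uniform convergence on `[0, b]`. The map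
  -- `Λ` does the same for the Lipschitz constants.
  let Θ : C(ℝ, H) → C(ℝ, H) := fun v =>
    ⟨fun s => G (history r v s) (history r w s), hF.continuous.comp ((hH v).prodMk (hH w))⟩
  have hΘ : Continuous Θ := by
    refine ContinuousMap.continuous_of_continuous_uncurry _ ?_
    exact hF.continuous.comp (continuous_history.prodMk ((hH w).comp continuous_snd))
  let Λ : C(ℝ, H) → C(ℝ, ℝ) := fun v =>
    ⟨fun s => ℓ (history r v s), hF.continuous_lip.comp (hH v)⟩
  have hΛ : Continuous Λ := by
    refine ContinuousMap.continuous_of_continuous_uncurry _ ?_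
    exact hF.continuous_lip.comp continuous_history
  have hΘ' := ContinuousMap.tendsto_iff_forall_isCompact_tendstoUniformlyOn.1
    ((hΘ.tendsto _).comp h) (Icc 0 b) isCompact_Icc
  have hΛ' := ContinuousMap.tendsto_iff_forall_isCompact_tendstoUniformlyOn.1
    ((hΛ.tendsto _).comp h) (Icc 0 b) isCompact_Icc
  rw [Metric.tendstoUniformlyOn_iff] at hΘ' hΛ'
  obtain ⟨K, hK⟩ := (isCompact_Icc (a := (0 : ℝ)) (b := b)).bddAbove_image
    (Λ (clip hr ha w)).continuous.continuousOn
  have hK' : ∀ s ∈ Icc 0 b, ℓ (history r (clip hr ha w) s) ≤ max K 0 := fun s hs =>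
    (hK ⟨s, hs, rfl⟩).trans (le_max_left _ _)
  -- The margin 1 allows for the Lipschitz constants along `ws n`, which are eventually within 1 of
  -- those along `w`.
  set K' := max K 0 + 1 with hK'def
  have hK'0 : 0 ≤ K' := by positivity
  refine tendsto_clip fun ε hε => ?_
  -- The amplification factor of `IsMildOn.norm_sub_le`; an error `ε / (2 * Q)` becomes `ε / 2`.
  set Q := 2 * ((1 + b) * Real.exp ((2 * K' + 1) * r)) * Real.exp ((2 * K' + 1) * b) with hQ
  have hQ0 : 0 < Q := by positivity
  set ε' := ε / (2 * Q) with hε'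
  have hε'0 : 0 < ε' := by positivity
  have hφ' := (tendsto_iff_norm_sub_tendsto_zero.1 hφ).eventually_lt_const hε'0
  filter_upwards [hΘ' ε' hε'0, hΛ' 1 one_pos, hφ'] with n h1 h2 h3 t ht
  have key := (hws n).norm_sub_le hS hF.continuous_diag hb hw (K := K') (ε := ε') hK'0 h3.le
    (by
      intro s hs
      have hs' : s ∈ Icc 0 (a + δ) := ⟨hs.1, hs.2.trans hba⟩
      rw [hF.apply_history (hr := hr) (ws n) ha hs', hF.apply_history (hr := hr) w ha hs']
      have h4 : ‖G (history r (clip hr ha (ws n)) s) (history r w s) -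
          G (history r (clip hr ha w) s) (history r w s)‖ < ε' := by
        have := h1 s hs
        rwa [dist_comm, dist_eq_norm] at this
      have h5 : ℓ (history r (clip hr ha (ws n)) s) ≤ K' := by
        have h6 := h2 s hs
        rw [dist_comm, Real.dist_eq] at h6
        have h7 := (le_abs_self _).trans h6.le
        change ℓ (history r (clip hr ha (ws n)) s) - ℓ (history r (clip hr ha w) s) ≤ 1 at h7
        linarith [hK' s hs]
      refine (norm_sub_le_norm_sub_add_norm_sub _
        (G (history r (clip hr ha (ws n)) s) (history r w s)) _).trans ?_
      refine add_le_add ((hF.lipschitz _ _ _).trans ?_) h4.le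
      exact mul_le_mul_of_nonneg_right h5 (norm_nonneg _)) t ht
  refine key.trans_lt ?_
  have : 2 * (ε' * (1 + b) * Real.exp ((2 * K' + 1) * r)) * Real.exp ((2 * K' + 1) * b) =
      ε / 2 := by
    have : 2 * (ε' * (1 + b) * Real.exp ((2 * K' + 1) * r)) * Real.exp ((2 * K' + 1) * b) =
      ε' * Q := by rw [hQ]; ring
    rw [this, hε']
    field_simp
  rw [this]
  linarith

/-- Continuous dependence of mild solutions on the initial data. -/
lemma IsIgnoringFactorization.tendsto_history (hS : IsContractionFamily S)
    (hF : IsIgnoringFactorization F G ℓ δ) {φs : ℕ → C(Icc (-r) 0, H)} {φ : C(Icc (-r) 0, H)}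
    (hφ : Tendsto φs atTop (𝓝 φ)) {T : ℝ}
    {ws : ℕ → C(ℝ, H)} {w : C(ℝ, H)} (hws : ∀ n, IsMildOn hr S F (φs n) T (ws n))
    (hw : IsMildOn hr S F φ T w) {t : ℝ} (ht : t ∈ Icc 0 T) :
    Tendsto (fun n => history r (ws n) t) atTop (𝓝 (history r w t)) := by
  have hT : 0 ≤ T := ht.1.trans ht.2
  have hδ := hF.pos
  -- Times are capped at `T`, beyond which the functions are not known to be solutions.
  have key : ∀ N : ℕ, ∀ h : 0 ≤ min (N * δ) T,
      Tendsto (fun n => clip hr h (ws n)) atTop (𝓝 (clip hr h w)) := by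
    intro N
    induction N with
    | zero =>
      intro h
      refine tendsto_clip fun ε hε => ?_
      have hφ' := (tendsto_iff_norm_sub_tendsto_zero.1 hφ).eventually_lt_const hε
      filter_upwards [hφ'] with n hn t ht
      have ht0 : t ≤ 0 := ht.2.trans (by simp)
      have h1 : ws n t - w t = (φs n - φ) ⟨t, ht.1, ht0⟩ := by
        rw [ContinuousMap.sub_apply, ← (hws n).initial, ← hw.initial]
      rw [h1]
      exact ((φs n - φ).norm_coe_le_norm _).trans_lt hn
    | succ N ih =>
      intro h
      have h0 : 0 ≤ min (N * δ) T := le_min (by positivity) hT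
      refine hF.tendsto_clip_extension hS hφ h0 h ?_
        (fun n => (hws n).mono (min_le_right _ _)) (hw.mono (min_le_right _ _)) (ih h0)
      push_cast
      rw [add_mul, one_mul, ← min_add_add_right]
      exact min_le_min_left _ (by linarith)
  obtain ⟨N, hN⟩ := exists_nat_ge (T / δ)
  have h0 : 0 ≤ min (N * δ) T := le_min (by positivity) hT
  have hNT : min (N * δ) T = T := min_eq_right ((div_le_iff₀ hδ).1 hN)
  have hclip : ∀ v : C(ℝ, H), history r (clip hr h0 v) t = history r v t := by
    intro v
    refine history_congr (T := T) (fun s hs => ?_) ht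
    exact clip_apply (by rwa [hNT])
  have := ((continuous_history (r := r)).comp
    (continuous_id.prodMk (continuous_const (y := t)))).tendsto (clip hr h0 w) |>.comp (key N h0)
  simpa [Function.comp_def, hclip] using this

/-- Continuous dependence applied to the constant sequence `w`: it converges both to `w` and to
`w'`. -/
lemma IsIgnoringFactorization.eq_of_isMildOn (hS : IsContractionFamily S)
    (hF : IsIgnoringFactorization F G ℓ δ) {φ : C(Icc (-r) 0, H)} {T : ℝ}
    {w w' : C(ℝ, H)} (hw : IsMildOn hr S F φ T w) (hw' : IsMildOn hr S F φ T w') {t : ℝ}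
    (ht : t ∈ Icc (-r) T) : w t = w' t := by
  rcases le_total t 0 with h0 | h0
  · exact (hw.initial ⟨t, ht.1, h0⟩).trans (hw'.initial ⟨t, ht.1, h0⟩).symm
  · have h := hF.tendsto_history hS tendsto_const_nhds (fun _ => hw) hw' ⟨h0, ht.2⟩
    have h' := tendsto_nhds_unique h tendsto_const_nhds
    simpa using (congrArg (fun q => q ⟨0, neg_nonpos.2 hr.le, le_rfl⟩) h').symm

/-- Mild solutions exist on the whole half-line. -/
lemma IsIgnoringFactorization.exists_global [CompleteSpace H] (hS : IsContractionFamily S)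
    (hF : IsIgnoringFactorization F G ℓ δ) (φ : C(Icc (-r) 0, H)) :
    ∃ w, ∀ T, 0 ≤ T → IsMildOn hr S F φ T w := by
  choose W hW using fun T => hF.exists_isMildOn (hr := hr) hS φ T
  have hWW : ∀ T T' t, 0 ≤ T → 0 ≤ T' → -r ≤ t → t ≤ T → t ≤ T' → W T t = W T' t := by
    intro T T' t _ _ h1 h2 h3
    exact hF.eq_of_isMildOn hS ((hW T).mono (min_le_left _ _))
      ((hW T').mono (min_le_right _ _)) ⟨h1, le_min h2 h3⟩
  -- The solution is glued with a horizon depending on the time. By uniqueness the horizon may be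
  -- frozen near each point, so continuity is inherited from a single `W R`.
  have hcont : Continuous fun t : ℝ => W (|max t (-r)| + 1) (max t (-r)) := by
    rw [continuous_iff_continuousAt]
    intro t₀
    set R := |max t₀ (-r)| + 2 with hR
    have h1 : ContinuousAt (fun t : ℝ => W R (max t (-r))) t₀ := by fun_prop
    refine h1.congr ?_
    have h2 : ∀ᶠ t in 𝓝 t₀, max t (-r) < R := by
      have : Continuous fun t : ℝ => max t (-r) := by fun_prop
      exact this.continuousAt.eventually_lt continuousAt_const
        ((le_abs_self _).trans_lt (by rw [hR]; linarith))
    filter_upwards [h2] with t ht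
    exact hWW _ _ _ (by positivity) (by positivity) (le_max_right _ _) ht.le
      ((le_abs_self _).trans (by linarith))
  refine ⟨⟨_, hcont⟩, fun T hT => (hW T).congr hT fun t ht => ?_⟩
  change W T t = W (|max t (-r)| + 1) (max t (-r))
  rw [max_eq_left ht.1]
  exact hWW _ _ _ hT (by positivity) ht.1 ht.2 ((le_abs_self _).trans (by linarith))

end DelayEquationDependence

/-! ### Classes in `L²` of bounded functions. -/

section SquareIntegrableClass

set_option linter.unusedSectionVars false

variable {X : Type*} [MeasurableSpace X] (ν : Measure X) [IsFiniteMeasure ν]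

/-- The class of `p` in `L²(ν)`, or `0` if `p` is not square integrable. -/
noncomputable def l2Class (p : X → ℝ) : Lp ℝ 2 ν :=
  open Classical in if h : MemLp p 2 ν then h.toLp p else 0

variable {ν}

lemma memLp_two_of_bounded {p : X → ℝ} (hp : Measurable p) {C : ℝ} (hC : ∀ x, |p x| ≤ C) :
    MemLp p 2 ν :=
  MemLp.of_bound hp.aestronglyMeasurable C (Eventually.of_forall hC)

lemma l2Class_of_memLp {p : X → ℝ} (hp : MemLp p 2 ν) : l2Class ν p = hp.toLp p := by
  simp [l2Class, hp]

lemma l2Class_congr {p q : X → ℝ} (h : p =ᵐ[ν] q) : l2Class ν p = l2Class ν q := by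
  by_cases hp : MemLp p 2 ν
  · rw [l2Class_of_memLp hp, l2Class_of_memLp (hp.ae_eq h)]
    exact MemLp.toLp_congr _ _ h
  · have hq : ¬ MemLp q 2 ν := fun hq => hp (hq.ae_eq h.symm)
    simp [l2Class, hp, hq]

lemma l2Class_add {p q : X → ℝ} (hp : MemLp p 2 ν) (hq : MemLp q 2 ν) :
    l2Class ν (fun x => p x + q x) = l2Class ν p + l2Class ν q := by
  rw [l2Class_of_memLp hp, l2Class_of_memLp hq, ← MemLp.toLp_add]
  exact l2Class_of_memLp (hp.add hq)

lemma l2Class_finsetSum {κ : Type*} (c : κ → ℝ) {p : κ → X → ℝ} (hp : ∀ k, MemLp (p k) 2 ν)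
    (s : Finset κ) :
    l2Class ν (fun x => ∑ k ∈ s, c k * p k x) = ∑ k ∈ s, c k • l2Class ν (p k) := by
  classical
  induction s using Finset.induction_on with
  | empty =>
    simp only [Finset.sum_empty]
    exact (l2Class_of_memLp MemLp.zero').trans (MemLp.toLp_zero _)
  | insert k s hk ih =>
    simp only [Finset.sum_insert hk]
    have h1 : MemLp (fun x => c k * p k x) 2 ν := (hp k).const_mul (c k)
    have h2 : MemLp (fun x => ∑ k ∈ s, c k * p k x) 2 ν :=
      memLp_finsetSum s fun i _ => (hp i).const_mul (c i)
    rw [l2Class_add h1 h2, ih, l2Class_of_memLp h1, l2Class_of_memLp (hp k)]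
    rfl

/-- The norm in `L²(ν)` of the constant function `1`. -/
noncomputable def l2Const (ν : Measure X) [IsFiniteMeasure ν] : ℝ :=
  (measureUnivNNReal ν : ℝ) ^ (2 : ℝ)⁻¹

lemma l2Const_nonneg : 0 ≤ l2Const ν := by unfold l2Const; positivity

lemma norm_l2Class_sub_le {p q : X → ℝ} (hp : MemLp p 2 ν) (hq : MemLp q 2 ν) {C : ℝ}
    (hC0 : 0 ≤ C) (hC : ∀ x, |p x - q x| ≤ C) :
    ‖l2Class ν p - l2Class ν q‖ ≤ l2Const ν * C := by
  rw [l2Class_of_memLp hp, l2Class_of_memLp hq, ← MemLp.toLp_sub]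
  have h := Lp.norm_le_of_ae_bound (f := (hp.sub hq).toLp (p - q)) hC0 (by
    filter_upwards [(hp.sub hq).coeFn_toLp] with x hx
    rw [hx]
    exact hC x)
  simpa [l2Const] using h

lemma norm_l2Class_le {p : X → ℝ} (hp : MemLp p 2 ν) {C : ℝ}
    (hC0 : 0 ≤ C) (hC : ∀ x, |p x| ≤ C) : ‖l2Class ν p‖ ≤ l2Const ν * C := by
  have h := norm_l2Class_sub_le hp (MemLp.zero' (p := 2)) hC0 (by simpa using hC)
  have h0 : l2Class ν (fun _ : X => (0 : ℝ)) = 0 :=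
    (l2Class_of_memLp MemLp.zero').trans (MemLp.toLp_zero _)
  rwa [h0, sub_zero] at h

lemma norm_tsum_sub_sum_le {κ E : Type*} [NormedAddCommGroup E] [CompleteSpace E] {a : κ → ℝ}
    (ha : Summable a) {u : κ → E} (hu : ∀ k, ‖u k‖ ≤ a k) (s : Finset κ) :
    ‖∑' k, u k - ∑ k ∈ s, u k‖ ≤ ∑' k, a k - ∑ k ∈ s, a k := by
  have h1 := (Summable.of_norm_bounded ha hu).sum_add_tsum_subtype_compl s
  have h2 := ha.sum_add_tsum_subtype_compl s
  rw [← h1, ← h2, add_sub_cancel_left, add_sub_cancel_left]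
  exact tsum_of_norm_bounded (ha.comp_injective Subtype.val_injective).hasSum fun k => hu k

/-- The pointwise remainder is at most `C` times the tail of `∑ |c k|`, uniformly in `x`; on a
finite measure space a uniform bound controls the `L²` norm. -/
lemma tsum_smul_l2Class {κ : Type*} [Countable κ] {c : κ → ℝ} (hc : Summable fun k => |c k|)
    {p : κ → X → ℝ} (hp : ∀ k, Measurable (p k)) {C : ℝ} (hC0 : 0 ≤ C)
    (hC : ∀ k x, |p k x| ≤ C) :
    MemLp (fun x => ∑' k, c k * p k x) 2 ν ∧
      ∑' k, c k • l2Class ν (p k) = l2Class ν fun x => ∑' k, c k * p k x := by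
  have hterm : ∀ x k, ‖c k * p k x‖ ≤ |c k| * C := by
    intro x k
    rw [norm_mul, Real.norm_eq_abs, Real.norm_eq_abs]
    exact mul_le_mul_of_nonneg_left (hC k x) (abs_nonneg _)
  have hs : ∀ x, Summable fun k => c k * p k x := fun x =>
    Summable.of_norm_bounded (hc.mul_right C) (hterm x)
  have hmem : MemLp (fun x => ∑' k, c k * p k x) 2 ν := by
    refine memLp_two_of_bounded (Measurable.tsum fun k => (hp k).const_mul (c k))
      (C := ∑' k, |c k| * C) fun x => ?_
    exact tsum_of_norm_bounded (hc.mul_right C).hasSum (hterm x)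
  refine ⟨hmem, HasSum.tsum_eq ?_⟩
  have hlim : Tendsto (fun s : Finset κ => l2Const ν * ((∑' k, |c k| - ∑ k ∈ s, |c k|) * C)) atTop
      (𝓝 0) := by
    have h1 : Tendsto (fun s : Finset κ => ∑ k ∈ s, |c k|) atTop (𝓝 (∑' k, |c k|)) := hc.hasSum
    have h2 := ((h1.const_sub (∑' k, |c k|)).mul_const C).const_mul (l2Const ν)
    simpa using h2
  refine tendsto_iff_norm_sub_tendsto_zero.2 (squeeze_zero (fun _ => norm_nonneg _)
    (fun s => ?_) hlim)
  have hpm : ∀ k, MemLp (p k) 2 ν := fun k => memLp_two_of_bounded (hp k) (hC k)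
  rw [← l2Class_finsetSum c hpm s, norm_sub_rev]
  refine norm_l2Class_sub_le hmem (memLp_finsetSum s fun i _ => (hpm i).const_mul (c i)) ?_ ?_
  · exact mul_nonneg (sub_nonneg.2 (hc.sum_le_tsum s fun _ _ => abs_nonneg _)) hC0
  · intro x
    refine (norm_tsum_sub_sum_le (hc.mul_right C) (hterm x) s).trans_eq ?_
    rw [tsum_mul_right, ← Finset.sum_mul, sub_mul]

end SquareIntegrableClass

/-! ### The nonlocal spatial operator `v ↦ ∫ b(v(y)) f(· - y) dy`. -/

section Kernel

variable {n : ℕ} {Ω : Set (EuclideanSpace ℝ (Fin n))}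

/-- A bounded and Lipschitz map from `L²(Ω)` to bounded measurable functions. -/
structure IsBoundedLipschitzFamily (B : L2 Ω → EuclideanSpace ℝ (Fin n) → ℝ) (C₀ C₁ : ℝ) :
    Prop where
  nonneg₀ : 0 ≤ C₀
  nonneg₁ : 0 ≤ C₁
  measurable : ∀ v, Measurable (B v)
  bound : ∀ v x, |B v x| ≤ C₀
  lipschitz : ∀ v w x, |B v x - B w x| ≤ C₁ * ‖v - w‖

/-- Outside a null set of differences, a bounded kernel agrees with a measurable one bounded
everywhere. -/
lemma exists_measurable_kernel (hΩ : IsOpen Ω) {f : EuclideanSpace ℝ (Fin n) → ℝ}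
    (hfm : AEMeasurable f (volume.restrict (Ω - Ω))) {M : ℝ} (hfM : ∀ x ∈ Ω - Ω, |f x| ≤ M) :
    ∃ f' : EuclideanSpace ℝ (Fin n) → ℝ, Measurable f' ∧ (∀ x, |f' x| ≤ |M|) ∧
      ∀ x ∈ Ω, ∀ᵐ y ∂(volume.restrict Ω), f (x - y) = f' (x - y) := by
  -- A measurable representative clamped to `[-|M|, |M|]`. Clamping changes nothing at almost every
  -- point of `Ω - Ω`, and `|M|` replaces `M`, which may be negative when `Ω` is empty.
  refine ⟨fun x => max (-|M|) (min |M| (hfm.mk f x)), by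
    exact measurable_const.max (measurable_const.min hfm.measurable_mk), fun x => ?_, ?_⟩
  · rw [abs_le]
    exact ⟨le_max_left _ _, max_le (by linarith [abs_nonneg M]) (min_le_left _ _)⟩
  · intro x hx
    have hmeas : MeasurableSet (Ω - Ω) := (hΩ.sub_right).measurableSet
    have h1 := (ae_restrict_iff' hmeas).1 hfm.ae_eq_mk
    have h2 := (Measure.measurePreserving_sub_left volume x).quasiMeasurePreserving.ae h1
    rw [ae_restrict_iff' hΩ.measurableSet]
    filter_upwards [h2] with y hy hyΩ
    have hmem : x - y ∈ Ω - Ω := Set.sub_mem_sub hx hyΩ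
    rw [← hy hmem]
    have h3 := abs_le.1 ((hfM _ hmem).trans (le_abs_self M))
    rw [min_eq_right h3.2, max_eq_right h3.1]

/-- The Lipschitz property of `b` gives a bound by the `L¹` norm of `v - w`, which the `L²` norm
controls because `Ω` has finite measure. Replacing the kernel by a measurable bounded one makes the
bounds valid for every `x`, not only in `Ω`. -/
lemma exists_isBoundedLipschitzFamily (hΩ : IsOpen Ω)
    (hΩb : Bornology.IsBounded Ω) {b : ℝ → ℝ} {L : ℝ≥0} (hbL : LipschitzWith L b) {Mb : ℝ}
    (hbM : ∀ s, |b s| ≤ Mb) {f : EuclideanSpace ℝ (Fin n) → ℝ}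
    (hfm : AEMeasurable f (volume.restrict (Ω - Ω))) {M : ℝ} (hfM : ∀ x ∈ Ω - Ω, |f x| ≤ M) :
    ∃ B C₀ C₁, IsBoundedLipschitzFamily (Ω := Ω) B C₀ C₁ ∧
      ∀ v, ∀ x ∈ Ω, ∫ y in Ω, b (v y) * f (x - y) = B v x := by
  have : IsFiniteMeasure ((volume : Measure (EuclideanSpace ℝ (Fin n))).restrict Ω) :=
    ⟨by simpa using hΩb.measure_lt_top⟩
  obtain ⟨f', hf'm, hf'M, hff'⟩ := exists_measurable_kernel hΩ hfm hfM
  set ν := (volume : Measure (EuclideanSpace ℝ (Fin n))).restrict Ω with hν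
  have hMb : 0 ≤ Mb := (abs_nonneg _).trans (hbM 0)
  have hjoint : ∀ v : L2 Ω, StronglyMeasurable
      fun p : EuclideanSpace ℝ (Fin n) × EuclideanSpace ℝ (Fin n) => b (v p.2) * f' (p.1 - p.2) := by
    intro v
    have h1 : Measurable fun p : EuclideanSpace ℝ (Fin n) × EuclideanSpace ℝ (Fin n) => v p.2 :=
      (Lp.stronglyMeasurable v).measurable.comp measurable_snd
    exact ((hbL.continuous.measurable.comp h1).mul
      (hf'm.comp (measurable_fst.sub measurable_snd))).stronglyMeasurable
  have hbd : ∀ (v : L2 Ω) x y, ‖b (v y) * f' (x - y)‖ ≤ Mb * |M| := by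
    intro v x y
    rw [norm_mul]
    exact mul_le_mul (hbM _) (hf'M _) (norm_nonneg _) hMb
  have hint : ∀ (v : L2 Ω) x, Integrable (fun y => b (v y) * f' (x - y)) ν := by
    intro v x
    exact Integrable.of_bound
      ((hjoint v).comp_measurable measurable_prodMk_left).aestronglyMeasurable (Mb * |M|)
      (Eventually.of_forall (hbd v x))
  -- The Hölder constant of the embedding of `L²(Ω)` into `L¹(Ω)`.
  set K : ℝ := (ν univ ^ (1 / (1 : ℝ≥0∞).toReal - 1 / (2 : ℝ≥0∞).toReal)).toReal with hK
  have hK0 : 0 ≤ K := ENNReal.toReal_nonneg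
  have hL1 : ∀ v : L2 Ω, ∫ y, ‖v y‖ ∂ν ≤ K * ‖v‖ := by
    intro v
    have h1 := eLpNorm_le_eLpNorm_mul_rpow_measure_univ (p := 1) (q := 2) (μ := ν) (f := v)
      (by norm_num) (Lp.aestronglyMeasurable v)
    rw [integral_norm_eq_lintegral_enorm (Lp.aestronglyMeasurable v),
      ← eLpNorm_one_eq_lintegral_enorm, Lp.norm_def, mul_comm, hK, ← ENNReal.toReal_mul]
    refine ENNReal.toReal_mono (ENNReal.mul_ne_top (Lp.eLpNorm_ne_top v) ?_) h1
    exact ENNReal.rpow_ne_top_of_nonneg (by norm_num) (measure_ne_top _ _)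
  refine ⟨fun v x => ∫ y, b (v y) * f' (x - y) ∂ν, Mb * |M| * ν.real univ,
    L * |M| * K, ⟨by positivity, by positivity,
    fun v => (hjoint v).integral_prod_right.measurable, fun v x => ?_, fun v w x => ?_⟩, ?_⟩
  · exact norm_integral_le_of_norm_le_const (Eventually.of_forall (hbd v x))
  · rw [← integral_sub (hint v x) (hint w x), ← Real.norm_eq_abs]
    have hvw : Integrable (fun y => (v - w) y) ν :=
      (Lp.memLp (v - w)).integrable (by norm_num)
    refine (norm_integral_le_of_norm_le (g := fun y => L * |M| * ‖(v - w) y‖)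
      (hvw.norm.const_mul _) ?_).trans ?_
    · filter_upwards [Lp.coeFn_sub v w] with y hy
      rw [hy, Pi.sub_apply, ← sub_mul, norm_mul, mul_right_comm]
      refine mul_le_mul ?_ (hf'M _) (norm_nonneg _) (by positivity)
      exact hbL.norm_sub_le _ _
    · rw [integral_const_mul, mul_assoc (L * |M| : ℝ)]
      exact mul_le_mul_of_nonneg_left (hL1 _) (by positivity)
  · intro v x hx
    refine integral_congr_ae ?_
    filter_upwards [hff' x hx] with y hy
    rw [hy]

end Kernel

/-- A Weierstrass test in which the majorants depend on the point: their tails are uniformly small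
on the preimage of a unit ball, which is a neighbourhood of the given point. -/
lemma continuous_tsum_of_tendstoUniformlyOn_isBounded {κ W Z E : Type*} [TopologicalSpace W]
    [PseudoMetricSpace Z] [NormedAddCommGroup E] [CompleteSpace E] {a : κ → Z → ℝ}
    (ha : ∀ z, Summable fun k => a k z)
    (hunif : ∀ B : Set Z, Bornology.IsBounded B →
      TendstoUniformlyOn (fun (s : Finset κ) z => ∑ k ∈ s, a k z) (fun z => ∑' k, a k z) atTop B)
    {π : W → Z} (hπ : Continuous π) {u : κ → W → E} (hu : ∀ k, Continuous (u k)) {C : ℝ}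
    (hC0 : 0 ≤ C) (hC : ∀ k w, ‖u k w‖ ≤ a k (π w) * C) :
    Continuous fun w => ∑' k, u k w := by
  refine continuous_iff_continuousAt.2 fun w₀ => ?_
  have hnhds : π ⁻¹' Metric.ball (π w₀) 1 ∈ 𝓝 w₀ :=
    hπ.continuousAt.preimage_mem_nhds (Metric.ball_mem_nhds _ one_pos)
  have hlim : TendstoUniformlyOn (fun (s : Finset κ) w => ∑ k ∈ s, u k w)
      (fun w => ∑' k, u k w) atTop (π ⁻¹' Metric.ball (π w₀) 1) := by
    rw [Metric.tendstoUniformlyOn_iff]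
    intro ε hε
    filter_upwards [Metric.tendstoUniformlyOn_iff.1 (hunif _ Metric.isBounded_ball) (ε / (C + 1))
      (by positivity)] with s hs w hw
    have h1 := hs (π w) hw
    rw [Real.dist_eq, lt_div_iff₀ (by positivity)] at h1
    have h2 := norm_tsum_sub_sum_le ((ha (π w)).mul_right C) (fun k => hC k w) s
    rw [tsum_mul_right, ← Finset.sum_mul, ← sub_mul] at h2
    rw [dist_eq_norm]
    have h3 := mul_le_mul_of_nonneg_right (le_abs_self (∑' k, a k (π w) - ∑ k ∈ s, a k (π w))) hC0
    nlinarith [abs_nonneg (∑' k, a k (π w) - ∑ k ∈ s, a k (π w))]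
  refine (hlim.continuousOn (Eventually.frequently (Eventually.of_forall fun s => ?_))).continuousAt
    hnhds
  exact (continuous_finsetSum s fun k _ => hu k).continuousOn

/-! ### The delay term `F`: discrete and continuous parts, and its factorization. -/

section DelayTerm

variable {n : ℕ} {Ω : Set (EuclideanSpace ℝ (Fin n))} {r : ℝ}
  [IsFiniteMeasure ((volume : Measure (EuclideanSpace ℝ (Fin n))).restrict Ω)]
  {B : L2 Ω → EuclideanSpace ℝ (Fin n) → ℝ} {C₀ C₁ : ℝ}
  {g gd gac gs : Icc (-r) 0 → Phase r Ω → ℝ} {ι : Type*} {η h : ι → Phase r Ω → ℝ}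

/-- The class in `L²(Ω)` of a bounded measurable function. -/
noncomputable abbrev l2ClassOn (Ω : Set (EuclideanSpace ℝ (Fin n)))
    [IsFiniteMeasure ((volume : Measure (EuclideanSpace ℝ (Fin n))).restrict Ω)]
    (p : EuclideanSpace ℝ (Fin n) → ℝ) : L2 Ω :=
  l2Class ((volume : Measure (EuclideanSpace ℝ (Fin n))).restrict Ω) p

/-- The norm of the constant `1` in `L²(Ω)`. -/
noncomputable abbrev l2ConstOn (Ω : Set (EuclideanSpace ℝ (Fin n)))
    [IsFiniteMeasure ((volume : Measure (EuclideanSpace ℝ (Fin n))).restrict Ω)] : ℝ :=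
  l2Const ((volume : Measure (EuclideanSpace ℝ (Fin n))).restrict Ω)

set_option linter.unusedSectionVars false

lemma IsBoundedLipschitzFamily.memLp (hB : IsBoundedLipschitzFamily (Ω := Ω) B C₀ C₁) (v : L2 Ω) :
    MemLp (B v) 2 ((volume : Measure (EuclideanSpace ℝ (Fin n))).restrict Ω) :=
  memLp_two_of_bounded (hB.measurable v) (hB.bound v)

lemma IsBoundedLipschitzFamily.norm_l2Class_sub_le
    (hB : IsBoundedLipschitzFamily (Ω := Ω) B C₀ C₁) (v w : L2 Ω) :
    ‖l2ClassOn Ω (B v) - l2ClassOn Ω (B w)‖ ≤ l2ConstOn Ω * C₁ * ‖v - w‖ := by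
  rw [mul_assoc]
  exact DelayPDE.norm_l2Class_sub_le (hB.memLp v) (hB.memLp w)
    (mul_nonneg hB.nonneg₁ (norm_nonneg _)) (hB.lipschitz v w)

lemma IsBoundedLipschitzFamily.continuous_l2Class
    (hB : IsBoundedLipschitzFamily (Ω := Ω) B C₀ C₁) : Continuous fun v => l2ClassOn Ω (B v) :=
  (LipschitzWith.of_dist_le' fun v w => by
    simpa only [dist_eq_norm] using hB.norm_l2Class_sub_le v w).continuous

lemma IsBoundedLipschitzFamily.continuous_apply
    (hB : IsBoundedLipschitzFamily (Ω := Ω) B C₀ C₁) (x : EuclideanSpace ℝ (Fin n)) :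
    Continuous fun v => B v x :=
  (LipschitzWith.of_dist_le' fun v w => by
    simpa only [dist_eq_norm, Real.norm_eq_abs] using hB.lipschitz v w x).continuous

/-- The point `-η_k(ψ)` of `[-r, 0]`. -/
def delayPoint (hA3 : ContinuousDiscreteDelays gd η h) (k : ι) (ψ : Phase r Ω) : Icc (-r) 0 :=
  ⟨-η k ψ, neg_le_neg (hA3.delay_mem k ψ).2, neg_nonpos.2 (hA3.delay_mem k ψ).1⟩

/-- The contribution of the jumps, with the jumps taken at `ψ` and the integrand at `χ`. -/
noncomputable def discreteTerm (B : L2 Ω → EuclideanSpace ℝ (Fin n) → ℝ)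
    (hA3 : ContinuousDiscreteDelays gd η h) (ψ χ : Phase r Ω) : L2 Ω :=
  ∑' k, h k ψ • l2ClassOn Ω (B (χ (delayPoint hA3 k ψ)))

/-- The contribution of the continuous part of the delay. -/
noncomputable def continuousTerm (B : L2 Ω → EuclideanSpace ℝ (Fin n) → ℝ)
    (gac gs : Icc (-r) 0 → Phase r Ω → ℝ) (χ : Phase r Ω) : L2 Ω :=
  l2ClassOn Ω fun x => stieltjesIntegral (fun θ => B (χ θ) x) fun θ => gac θ χ + gs θ χ

lemma continuous_tsum_abs_jump (hA3 : ContinuousDiscreteDelays gd η h) :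
    Continuous fun ψ => ∑' k, |h k ψ| :=
  continuous_tsum_of_tendstoUniformlyOn_isBounded (a := fun k ψ => |h k ψ|)
    hA3.summable hA3.uniform continuous_id
    (fun k => (hA3.jump_continuous k).abs) zero_le_one fun k ψ => by simp

lemma norm_discreteTerm_summand_le (hB : IsBoundedLipschitzFamily (Ω := Ω) B C₀ C₁) (c : ℝ)
    (v : L2 Ω) : ‖c • l2ClassOn Ω (B v)‖ ≤ |c| * (l2ConstOn Ω * C₀) := by
  rw [norm_smul, Real.norm_eq_abs]
  exact mul_le_mul_of_nonneg_left (norm_l2Class_le (hB.memLp v) hB.nonneg₀ (hB.bound v))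
    (abs_nonneg _)

lemma continuous_discreteTerm (hB : IsBoundedLipschitzFamily (Ω := Ω) B C₀ C₁)
    (hA3 : ContinuousDiscreteDelays gd η h) :
    Continuous fun p : Phase r Ω × Phase r Ω => discreteTerm B hA3 p.1 p.2 := by
  refine continuous_tsum_of_tendstoUniformlyOn_isBounded (a := fun k ψ => |h k ψ|)
    hA3.summable hA3.uniform
    (continuous_fst (X := Phase r Ω) (Y := Phase r Ω))
    (C := l2ConstOn Ω * C₀) (fun k => ?_) (mul_nonneg l2Const_nonneg hB.nonneg₀) fun k p =>
      norm_discreteTerm_summand_le hB _ _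
  have h1 : Continuous fun p : Phase r Ω × Phase r Ω => delayPoint hA3 k p.1 :=
    (((hA3.delay_continuous k).comp continuous_fst).neg).subtype_mk _
  have h2 : Continuous fun p : Phase r Ω × Phase r Ω => p.2 (delayPoint hA3 k p.1) :=
    continuous_eval.comp (continuous_snd.prodMk h1)
  exact ((hA3.jump_continuous k).comp continuous_fst).smul (hB.continuous_l2Class.comp h2)

/-- With the delays frozen at `ψ`, both states are evaluated at the same points, so only the
Lipschitz property of `B` enters. -/
lemma norm_discreteTerm_sub_le (hB : IsBoundedLipschitzFamily (Ω := Ω) B C₀ C₁)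
    (hA3 : ContinuousDiscreteDelays gd η h) (ψ χ χ' : Phase r Ω) :
    ‖discreteTerm B hA3 ψ χ - discreteTerm B hA3 ψ χ'‖ ≤
      (∑' k, |h k ψ|) * (l2ConstOn Ω * C₁) * ‖χ - χ'‖ := by
  have hs : ∀ χ : Phase r Ω,
      Summable fun k => h k ψ • l2ClassOn Ω (B (χ (delayPoint hA3 k ψ))) := fun χ =>
    Summable.of_norm_bounded ((hA3.summable ψ).mul_right _)
      fun k => norm_discreteTerm_summand_le hB _ _
  rw [discreteTerm, discreteTerm, ← (hs χ).tsum_sub (hs χ'), mul_assoc, ← tsum_mul_right]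
  refine tsum_of_norm_bounded ((hA3.summable ψ).mul_right _).hasSum fun k => ?_
  rw [← smul_sub, norm_smul, Real.norm_eq_abs]
  refine mul_le_mul_of_nonneg_left ((hB.norm_l2Class_sub_le _ _).trans ?_) (abs_nonneg _)
  exact mul_le_mul_of_nonneg_left ((χ - χ').norm_coe_le_norm _)
    (mul_nonneg l2Const_nonneg hB.nonneg₁)

lemma IsBoundedLipschitzFamily.continuous_comp (hB : IsBoundedLipschitzFamily (Ω := Ω) B C₀ C₁)
    (χ : Phase r Ω) (x : EuclideanSpace ℝ (Fin n)) : Continuous fun θ => B (χ θ) x :=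
  (hB.continuous_apply x).comp χ.continuous

lemma memLp_stieltjesIntegral (hB : IsBoundedLipschitzFamily (Ω := Ω) B C₀ C₁) (χ : Phase r Ω)
    (G : Icc (-r) 0 → ℝ) {C : ℝ} (hC : ∀ x, |stieltjesIntegral (fun θ => B (χ θ) x) G| ≤ C) :
    MemLp (fun x => stieltjesIntegral (fun θ => B (χ θ) x) G) 2
      ((volume : Measure (EuclideanSpace ℝ (Fin n))).restrict Ω) :=
  memLp_two_of_bounded (measurable_stieltjesIntegral G
    (χ := fun x θ => B (χ θ) x) (fun _ => hB.measurable _) (hB.continuous_comp χ)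
    fun _ _ => hB.bound _ _) hC

section Splitting

variable {hr : 0 < r}

lemma IsSplitting.continuous (hg : IsSplitting hr g gd gac gs) (φ : Phase r Ω) :
    Continuous fun θ => gac θ φ + gs θ φ :=
  (hg.absolutelyContinuous φ).continuous.add (hg.singular φ).1

lemma IsSplitting.boundedVariationOn (hg : IsSplitting hr g gd gac gs) (φ : Phase r Ω) :
    BoundedVariationOn (fun θ => gac θ φ + gs θ φ) univ := by
  have hs := (hg.singular φ).2.1
  convert boundedVariationOn_sub (hg.absolutelyContinuous φ).boundedVariationOn
    (boundedVariationOn_sub (boundedVariationOn_sub hs hs) hs) using 2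
  ring

lemma IsSplitting.stieltjesIntegral_eq [Countable ι] (hg : IsSplitting hr g gd gac gs) {M : ℝ}
    (hM : 0 ≤ M) (hgM : ∀ φ, eVariationOn (fun θ => g θ φ) univ ≤ ENNReal.ofReal M)
    (hA3 : ContinuousDiscreteDelays gd η h) (φ : Phase r Ω) {χ : Icc (-r) 0 → ℝ}
    (hχ : Measurable χ) {C : ℝ} (hC0 : 0 ≤ C) (hC : ∀ θ, |χ θ| ≤ C) :
    stieltjesIntegral χ (fun θ => g θ φ) = ∑' k, h k φ * χ (delayPoint hA3 k φ) +
        stieltjesIntegral χ (fun θ => gac θ φ + gs θ φ) ∧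
      |stieltjesIntegral χ (fun θ => gac θ φ + gs θ φ)| ≤ 2 * M * C := by
  refine stieltjesIntegral_splitting hr hM (hgM φ) (hg.boundedVariationOn φ) (hg.continuous φ)
    (fun θ => (hg.sum_eq θ φ).trans (add_assoc _ _ _)) (hg.step φ) (hA3.summable φ)
    (fun θ => ?_) hχ hC0 hC
  rw [hA3.jump_eq φ θ]
  have e : ∀ k, (θ : ℝ) = -η k φ ↔ θ = delayPoint hA3 k φ := fun _ =>
    ⟨fun hk => Subtype.ext hk, fun hk => congrArg Subtype.val hk⟩
  exact (Equiv.subtypeEquivRight e).tsum_eq fun k => h k φ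

/-- Changing the integrand against a fixed measure costs `2 * M * C₁`, by (A1) carried over to the
continuous part; changing the measure under a fixed integrand costs `2 * L * C₀`, by (A4). The
factors 2 come from comparing the mass of the Stieltjes measure with the total variation. -/
lemma IsSplitting.norm_continuousTerm_sub_le [Countable ι] (hg : IsSplitting hr g gd gac gs)
    {M : ℝ} (hM : 0 ≤ M) (hgM : ∀ φ, eVariationOn (fun θ => g θ φ) univ ≤ ENNReal.ofReal M)
    (hA3 : ContinuousDiscreteDelays gd η h) {L : ℝ} (hL : 0 ≤ L)
    (hgL : ∀ φ ψ : Phase r Ω, eVariationOn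
      (fun θ => (gac θ φ + gs θ φ) - (gac θ ψ + gs θ ψ)) univ ≤ ENNReal.ofReal (L * ‖φ - ψ‖))
    (hB : IsBoundedLipschitzFamily (Ω := Ω) B C₀ C₁) (χ χ' : Phase r Ω) :
    ‖continuousTerm B gac gs χ - continuousTerm B gac gs χ'‖ ≤
      l2ConstOn Ω * (2 * M * C₁ + 2 * L * C₀) * ‖χ - χ'‖ := by
  have hmem : ∀ χ : Phase r Ω, MemLp (fun x => stieltjesIntegral (fun θ => B (χ θ) x)
      fun θ => gac θ χ + gs θ χ) 2
      ((volume : Measure (EuclideanSpace ℝ (Fin n))).restrict Ω) := fun χ =>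
    memLp_stieltjesIntegral hB χ _ fun x => (hg.stieltjesIntegral_eq hM hgM hA3 χ
      (hB.continuous_comp χ x).measurable hB.nonneg₀ fun θ => hB.bound _ _).2
  have h₀ := hB.nonneg₀
  have h₁ := hB.nonneg₁
  rw [mul_assoc]
  refine norm_l2Class_sub_le (hmem χ) (hmem χ') (by positivity) fun x => ?_
  have hm := (hB.continuous_comp χ x).measurable
  have hm' := (hB.continuous_comp χ' x).measurable
  have h1 := (hg.stieltjesIntegral_eq hM hgM hA3 χ (hm.sub hm')
    (mul_nonneg h₁ (norm_nonneg (χ - χ'))) fun θ => (hB.lipschitz _ _ x).trans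
      (mul_le_mul_of_nonneg_left ((χ - χ').norm_coe_le_norm θ) h₁)).2
  have h2 := abs_stieltjesIntegral_le hr h₀ (by positivity) (fun θ => hB.bound (χ' θ) x) (hgL χ χ')
  have e1 := stieltjesIntegral_sub_left (G := fun θ => gac θ χ + gs θ χ) hm hm'
    (fun θ => hB.bound _ x) (fun θ => hB.bound _ x)
  have e2 := stieltjesIntegral_sub_right hr hm' (fun θ => hB.bound _ x)
    (hg.boundedVariationOn χ) (hg.boundedVariationOn χ')
  rw [e2] at h2
  change |stieltjesIntegral (fun θ => B (χ θ) x - B (χ' θ) x) _| ≤ _ at h1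
  rw [e1] at h1
  refine (abs_sub_le _ _ _).trans ((add_le_add h1 h2).trans_eq (by ring))

lemma IsSplitting.delayFun_memLp_and_eq [Countable ι] (hΩ : MeasurableSet Ω)
    (hg : IsSplitting hr g gd gac gs)
    {M : ℝ} (hM : 0 ≤ M) (hgM : ∀ φ, eVariationOn (fun θ => g θ φ) univ ≤ ENNReal.ofReal M)
    (hA3 : ContinuousDiscreteDelays gd η h) (hB : IsBoundedLipschitzFamily (Ω := Ω) B C₀ C₁)
    {b : ℝ → ℝ} {f : EuclideanSpace ℝ (Fin n) → ℝ}
    (hbB : ∀ v : L2 Ω, ∀ x ∈ Ω, ∫ y in Ω, b (v y) * f (x - y) = B v x) (φ : Phase r Ω) :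
    MemLp (delayFun b f g φ) 2 (volume.restrict Ω) ∧
      delayTerm b f g φ = discreteTerm B hA3 φ φ + continuousTerm B gac gs φ := by
  have hsplit := fun x => hg.stieltjesIntegral_eq hM hgM hA3 φ
      (hB.continuous_comp φ x).measurable hB.nonneg₀ fun θ => hB.bound _ _
  obtain ⟨hm1, he1⟩ := tsum_smul_l2Class
    (ν := (volume : Measure (EuclideanSpace ℝ (Fin n))).restrict Ω) (hA3.summable φ)
    (p := fun k => B (φ (delayPoint hA3 k φ))) (fun k => hB.measurable _) hB.nonneg₀
    fun k x => hB.bound _ x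
  have hm2 := memLp_stieltjesIntegral hB φ _ fun x => (hsplit x).2
  -- `B` reproduces the inner integral only for `x ∈ Ω`, so the identity is one between classes in
  -- `L²(Ω)`.
  have hae : delayFun b f g φ =ᵐ[volume.restrict Ω] fun x =>
      ∑' k, h k φ * B (φ (delayPoint hA3 k φ)) x +
        stieltjesIntegral (fun θ => B (φ θ) x) (fun θ => gac θ φ + gs θ φ) := by
    filter_upwards [ae_restrict_mem hΩ] with x hx
    rw [← (hsplit x).1, delayFun]
    congr 1
    ext θ
    exact hbB _ x hx
  refine ⟨(hm1.add hm2).ae_eq hae.symm, ?_⟩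
  change l2Class _ (delayFun b f g φ) = _
  rw [l2Class_congr hae, l2Class_add hm1 hm2, ← he1]
  rfl

end Splitting

/-- The right-hand side of the delay equation is Lipschitz up to its dependence on the jumps, which
ignores the values of the state on `(-η_ign, 0]`. -/
lemma exists_isIgnoringFactorization [Countable ι] {hr : 0 < r} (hΩ : IsOpen Ω)
    (hg : IsSplitting hr g gd gac gs) (hA1 : UniformlyBoundedVariation g)
    (hA3 : ContinuousDiscreteDelays gd η h) (hA4 : LipschitzVariation gac gs)
    (hA5 : UniformIgnoring η h) (hB : IsBoundedLipschitzFamily (Ω := Ω) B C₀ C₁)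
    {b : ℝ → ℝ} {f : EuclideanSpace ℝ (Fin n) → ℝ}
    (hbB : ∀ v : L2 Ω, ∀ x ∈ Ω, ∫ y in Ω, b (v y) * f (x - y) = B v x) (d : ℝ) :
    ∃ G ℓ δ, IsIgnoringFactorization
      (fun φ : Phase r Ω => delayTerm b f g φ - d • φ ⟨0, neg_nonpos.2 hr.le, le_rfl⟩) G ℓ δ := by
  obtain ⟨M, hM, hgM⟩ := hA1
  obtain ⟨L, hL, hgL⟩ := hA4
  obtain ⟨δ, hδ, hign⟩ := hA5
  have hcont := hg.norm_continuousTerm_sub_le hM.le hgM hA3 hL hgL hB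
  -- Only the delays and the jumps are charged to `ψ`; the continuous part and the damping are
  -- Lipschitz and go with `χ`.
  refine ⟨fun ψ χ => discreteTerm B hA3 ψ χ + continuousTerm B gac gs χ -
      d • χ ⟨0, neg_nonpos.2 hr.le, le_rfl⟩,
    fun ψ => (∑' k, |h k ψ|) * (l2ConstOn Ω * C₁) +
      l2ConstOn Ω * (2 * M * C₁ + 2 * L * C₀) + |d|, δ, ?_⟩
  refine ⟨?_, fun φ => ?_, fun ψ χ χ' => ?_, ?_, hδ, fun φ ψ hφψ => ?_⟩
  · have h1 : Continuous (continuousTerm B gac gs) :=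
      (LipschitzWith.of_dist_le' fun v w => by
        simpa only [dist_eq_norm] using hcont v w).continuous
    exact ((continuous_discreteTerm hB hA3).add (h1.comp continuous_snd)).sub
      (((continuous_eval_const _).comp continuous_snd).const_smul d)
  · rw [(hg.delayFun_memLp_and_eq hΩ.measurableSet hM.le hgM hA3 hB hbB φ).2]
  · have e : ∀ a a' c c' u u' : L2 Ω, a + c - u - (a' + c' - u') = (a - a') + (c - c') - (u - u') :=
      fun _ _ _ _ _ _ => by abel
    rw [e, add_mul, add_mul, ← smul_sub]
    refine (norm_sub_le _ _).trans (add_le_add ((norm_add_le _ _).trans (add_le_add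
      (norm_discreteTerm_sub_le hB hA3 ψ χ χ') (hcont χ χ'))) ?_)
    rw [norm_smul, Real.norm_eq_abs]
    exact mul_le_mul_of_nonneg_left ((χ - χ').norm_coe_le_norm _) (abs_nonneg _)
  · exact (((continuous_tsum_abs_jump hA3).mul_const _).add_const _).add_const _
  · ext1 χ
    have h1 := hign φ ψ hφψ
    simp only [discreteTerm, delayPoint, fun k => (h1 k).1, fun k => (h1 k).2]

end DelayTerm

/-! ### Transfer from the abstract delay equation to mild solutions. -/

section MildSolution

set_option linter.unusedSectionVars false

variable {H : Type*} [NormedAddCommGroup H] [InnerProductSpace ℝ H] [CompleteSpace H]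
  {A : H →ₗ.[ℝ] H}

/-- The semigroup `e^{-tA}`, extended by the identity to negative times. -/
noncomputable def extendedExpNeg (A : H →ₗ.[ℝ] H) (t : ℝ) (v : H) : H := expNeg A (max t 0) v

lemma HasNonnegSpectralResolution.isContractionFamily (h : HasNonnegSpectralResolution A) :
    IsContractionFamily (extendedExpNeg A) where
  continuous := h.continuous_expNeg
  zero v := by simp [extendedExpNeg, h.expNeg_zero]
  norm_sub_le t v w := by
    rw [extendedExpNeg, extendedExpNeg, ← h.expNeg_sub (le_max_right _ _)]
    exact h.norm_expNeg_le (le_max_right _ _) _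

/-- The extension of `u` from `[-r, T]` to the line by constants. -/
noncomputable def extendConst {r T : ℝ} (hr : 0 < r) (hT : 0 < T) (u : C(Icc (-r) T, H)) :
    C(ℝ, H) where
  toFun t := u (projIcc (-r) T (neg_le_of_pos hr hT) t)
  continuous_toFun := u.continuous.comp continuous_projIcc

variable {r T d : ℝ} {hr : 0 < r} {hT : 0 < T} {F : C(Icc (-r) 0, H) → H}

lemma extendConst_apply (u : C(Icc (-r) T, H)) {t : ℝ} (ht : t ∈ Icc (-r) T) :
    extendConst hr hT u t = u ⟨t, ht⟩ :=
  congrArg u (projIcc_of_mem _ ht)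

/-- Only times `s ≤ t ≤ T` enter the integral, so neither the extension of the semigroup to negative
times nor that of `u` beyond `[-r, T]` matters. Integrability is automatic, since the extended
integrand is continuous. -/
lemma isMildSolution_iff (hA : HasNonnegSpectralResolution A)
    (hF : Continuous fun φ => F φ - d • φ ⟨0, neg_nonpos.2 hr.le, le_rfl⟩)
    {φ : C(Icc (-r) 0, H)} {u : C(Icc (-r) T, H)} :
    IsMildSolution hr hT A d F φ u ↔ IsMildOn hr (extendedExpNeg A)
      (fun φ => F φ - d • φ ⟨0, neg_nonpos.2 hr.le, le_rfl⟩) φ T (extendConst hr hT u) := by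
  have hint : ∀ t ∈ Icc 0 T, ∀ s ∈ Icc 0 t, extendedExpNeg A (t - s)
      ((fun φ => F φ - d • φ ⟨0, neg_nonpos.2 hr.le, le_rfl⟩)
        (history r (extendConst hr hT u) s)) = expNeg A (t - s)
      (F (segment hr hT u s) - d • u (projIcc (-r) T (neg_le_of_pos hr hT) s)) := by
    intro t _ s hs
    have h0 : history r (extendConst hr hT u) s ⟨0, neg_nonpos.2 hr.le, le_rfl⟩ =
        u (projIcc (-r) T (neg_le_of_pos hr hT) s) := by
      rw [history_apply, add_zero]
      rfl
    simp only [h0, extendedExpNeg, max_eq_left (sub_nonneg.2 hs.2)]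
    rfl
  have heq : ∀ t ∈ Icc 0 T, duhamel (extendedExpNeg A)
      (fun φ => F φ - d • φ ⟨0, neg_nonpos.2 hr.le, le_rfl⟩)
      (φ ⟨0, neg_nonpos.2 hr.le, le_rfl⟩) (extendConst hr hT u) t =
      expNeg A t (φ ⟨0, neg_nonpos.2 hr.le, le_rfl⟩) + ∫ s in (0 : ℝ)..t, expNeg A (t - s)
      (F (segment hr hT u s) - d • u (projIcc (-r) T (neg_le_of_pos hr hT) s)) := by
    intro t ht
    rw [duhamel]
    congr 1
    · rw [extendedExpNeg, max_eq_left ht.1]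
    · refine intervalIntegral.integral_congr fun s hs => ?_
      rw [uIcc_of_le ht.1] at hs
      exact hint t ht s hs
  constructor
  · intro h
    refine ⟨fun θ => ?_, fun t ht => ?_⟩
    · rw [extendConst_apply u ⟨θ.2.1, θ.2.2.trans hT.le⟩, h.initial]
    · rw [heq t ht, ← h.eq t ht]
      exact extendConst_apply u _
  · intro h
    refine ⟨fun θ => ?_, fun t ht => ?_, fun t ht => ?_⟩
    · rw [← h.initial, extendConst_apply u ⟨θ.2.1, θ.2.2.trans hT.le⟩]
    · have hc : Continuous fun s => extendedExpNeg A (t - s)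
          ((fun φ => F φ - d • φ ⟨0, neg_nonpos.2 hr.le, le_rfl⟩)
            (history r (extendConst hr hT u) s)) :=
        (continuous_duhamel_integrand hA.isContractionFamily hF (extendConst hr hT u)).comp
          (continuous_const.prodMk continuous_id)
      refine (intervalIntegrable_congr fun s hs => ?_).1 (hc.intervalIntegrable 0 t)
      rw [uIoc_of_le ht.1] at hs
      exact hint t ht s ⟨hs.1.le, hs.2⟩
    · rw [← heq t ht, ← h.eq t ht]
      exact (extendConst_apply u _).symm

lemma isMildSolution_of_isMildOn (hA : HasNonnegSpectralResolution A)
    (hF : Continuous fun φ => F φ - d • φ ⟨0, neg_nonpos.2 hr.le, le_rfl⟩)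
    {φ : C(Icc (-r) 0, H)} {u : C(Icc (-r) T, H)} {w : C(ℝ, H)}
    (hw : IsMildOn hr (extendedExpNeg A)
      (fun φ => F φ - d • φ ⟨0, neg_nonpos.2 hr.le, le_rfl⟩) φ T w) (hu : ∀ t, u t = w t) :
    IsMildSolution hr hT A d F φ u :=
  (isMildSolution_iff hA hF).2 (hw.congr hT.le fun t ht => by rw [extendConst_apply u ht, hu])

variable {G : C(Icc (-r) 0, H) → C(Icc (-r) 0, H) → H} {ℓ : C(Icc (-r) 0, H) → ℝ} {δ : ℝ}

lemma IsMildSolution.unique (hA : HasNonnegSpectralResolution A) (hF : IsIgnoringFactorization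
      (fun φ => F φ - d • φ ⟨0, neg_nonpos.2 hr.le, le_rfl⟩) G ℓ δ)
    {φ : C(Icc (-r) 0, H)} {u u' : C(Icc (-r) T, H)} (hu : IsMildSolution hr hT A d F φ u)
    (hu' : IsMildSolution hr hT A d F φ u') : u = u' := by
  ext t
  have h := hF.eq_of_isMildOn hA.isContractionFamily
    ((isMildSolution_iff hA hF.continuous_diag).1 hu)
    ((isMildSolution_iff hA hF.continuous_diag).1 hu') t.2
  rwa [extendConst_apply u t.2, extendConst_apply u' t.2] at h

lemma existsUnique_isMildSolution (hA : HasNonnegSpectralResolution A)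
    (hF : IsIgnoringFactorization
      (fun φ => F φ - d • φ ⟨0, neg_nonpos.2 hr.le, le_rfl⟩) G ℓ δ) (φ : C(Icc (-r) 0, H)) :
    (∀ (T : ℝ) (hT : 0 < T), ∃! u : C(Icc (-r) T, H), IsMildSolution hr hT A d F φ u) ∧
      ∃! u : C(Ici (-r), H), ∀ (T : ℝ) (hT : 0 < T),
        IsMildSolution hr hT A d F φ (restrictTo T u) := by
  obtain ⟨w, hw⟩ := hF.exists_global (hr := hr) hA.isContractionFamily φ
  refine ⟨fun T hT => ⟨⟨fun t => w t, by fun_prop⟩, ?_, fun u' hu' => ?_⟩,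
    ⟨fun t => w t, by fun_prop⟩, fun T hT => ?_, fun u' hu' => ?_⟩
  · exact isMildSolution_of_isMildOn hA hF.continuous_diag (hw T hT.le) fun _ => rfl
  · exact hu'.unique hA hF
      (isMildSolution_of_isMildOn hA hF.continuous_diag (hw T hT.le) fun _ => rfl)
  · exact isMildSolution_of_isMildOn hA hF.continuous_diag (hw T hT.le) fun _ => rfl
  · ext t
    -- A positive horizon beyond `t`, so that uniqueness on a finite interval decides the value at
    -- `t`.
    have hT : 0 < |(t : ℝ)| + 1 := by positivity
    have h := (hu' _ hT).unique hA hF (isMildSolution_of_isMildOn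
      (u := ⟨fun t => w t, by fun_prop⟩) hA hF.continuous_diag (hw _ hT.le) fun _ => rfl)
    exact congrArg (fun u => u ⟨t, t.2, by linarith [le_abs_self (t : ℝ)]⟩) h

lemma IsMildSolution.tendsto_segment (hA : HasNonnegSpectralResolution A)
    (hF : IsIgnoringFactorization
      (fun φ => F φ - d • φ ⟨0, neg_nonpos.2 hr.le, le_rfl⟩) G ℓ δ)
    {φs : ℕ → C(Icc (-r) 0, H)} {φ : C(Icc (-r) 0, H)} (hφ : Tendsto φs atTop (𝓝 φ))
    {us : ℕ → C(Icc (-r) T, H)} {u : C(Icc (-r) T, H)}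
    (hus : ∀ m, IsMildSolution hr hT A d F (φs m) (us m)) (hu : IsMildSolution hr hT A d F φ u)
    {t : ℝ} (ht : t ∈ Icc 0 T) :
    Tendsto (fun m => segment hr hT (us m) t) atTop (𝓝 (segment hr hT u t)) :=
  hF.tendsto_history hA.isContractionFamily hφ
    (fun m => (isMildSolution_iff hA hF.continuous_diag).1 (hus m))
    ((isMildSolution_iff hA hF.continuous_diag).1 hu) ht

end MildSolution

end DelayPDE

theorem theorem2 {n : ℕ} {Ω : Set (EuclideanSpace ℝ (Fin n))} (hΩ : IsOpen Ω)
    (hΩb : Bornology.IsBounded Ω)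
    {r : ℝ} (hr : 0 < r) {d : ℝ} (hd : 0 ≤ d)
    (A : DelayPDE.L2 Ω →ₗ.[ℝ] DelayPDE.L2 Ω)
    (hAd : Dense (A.domain : Set (DelayPDE.L2 Ω))) (hAsa : IsSelfAdjoint A)
    (hApos : DelayPDE.IsPositive A) (hAc : DelayPDE.HasCompactResolvent A)
    (b : ℝ → ℝ) (hbL : ∃ L : ℝ≥0, LipschitzWith L b) (hbM : ∃ M : ℝ, ∀ s, |b s| ≤ M)
    (f : EuclideanSpace ℝ (Fin n) → ℝ) (hfm : AEMeasurable f (volume.restrict (Ω - Ω)))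
    (hfM : ∃ M : ℝ, ∀ x ∈ Ω - Ω, |f x| ≤ M)
    (g gd gac gs : Icc (-r) 0 → DelayPDE.Phase r Ω → ℝ)
    (hg : DelayPDE.IsSplitting hr g gd gac gs)
    {ι : Type*} [Countable ι] (η h : ι → DelayPDE.Phase r Ω → ℝ)
    (hA1 : DelayPDE.UniformlyBoundedVariation g)
    (hA2 : DelayPDE.ContinuousInState gac gs)
    (hA3 : DelayPDE.ContinuousDiscreteDelays gd η h)
    (hA4 : DelayPDE.LipschitzVariation gac gs)
    (hA5 : DelayPDE.UniformIgnoring η h) :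
    -- `F` takes its values in `L²(Ω)`
    (∀ φ, MemLp (DelayPDE.delayFun b f g φ) 2 (volume.restrict Ω)) ∧
    -- existence and uniqueness of the mild solution, on every `[-r, T]` and on `[-r, ∞)`
    (∀ φ : DelayPDE.Phase r Ω,
      (∀ (T : ℝ) (hT : 0 < T), ∃! u : C(Icc (-r) T, DelayPDE.L2 Ω),
        DelayPDE.IsMildSolution hr hT A d (DelayPDE.delayTerm b f g) φ u) ∧
      ∃! u : C(Ici (-r), DelayPDE.L2 Ω), ∀ (T : ℝ) (hT : 0 < T),
        DelayPDE.IsMildSolution hr hT A d (DelayPDE.delayTerm b f g) φ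
          (DelayPDE.restrictTo T u)) ∧
    -- continuous dependence on the initial data
    (∀ (φs : ℕ → DelayPDE.Phase r Ω) (φ : DelayPDE.Phase r Ω),
      Tendsto (fun m => ‖φs m - φ‖) atTop (𝓝 0) →
      ∀ (T : ℝ) (hT : 0 < T) (us : ℕ → C(Icc (-r) T, DelayPDE.L2 Ω))
        (u : C(Icc (-r) T, DelayPDE.L2 Ω)),
        (∀ m, DelayPDE.IsMildSolution hr hT A d (DelayPDE.delayTerm b f g) (φs m) (us m)) →
        DelayPDE.IsMildSolution hr hT A d (DelayPDE.delayTerm b f g) φ u →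
        ∀ t ∈ Icc 0 T, Tendsto
          (fun m => ‖DelayPDE.segment hr hT (us m) t - DelayPDE.segment hr hT u t‖)
          atTop (𝓝 0)) := by
  have : IsFiniteMeasure ((volume : Measure (EuclideanSpace ℝ (Fin n))).restrict Ω) :=
    ⟨by simpa using hΩb.measure_lt_top⟩
  obtain ⟨L, hbL⟩ := hbL
  obtain ⟨Mb, hbM⟩ := hbM
  obtain ⟨Mf, hfM⟩ := hfM
  obtain ⟨B, C₀, C₁, hB, hbB⟩ := DelayPDE.exists_isBoundedLipschitzFamily hΩ hΩb hbL hbM hfm hfM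
  obtain ⟨G, ℓ, δ, hF⟩ :=
    DelayPDE.exists_isIgnoringFactorization hΩ hg hA1 hA3 hA4 hA5 hB hbB d
  have hA := DelayPDE.hasNonnegSpectralResolution hAd hAsa hApos hAc
  obtain ⟨M, hM, hgM⟩ := hA1
  refine ⟨fun φ =>
      (hg.delayFun_memLp_and_eq hΩ.measurableSet hM.le hgM hA3 hB hbB φ).1,
    DelayPDE.existsUnique_isMildSolution hA hF, ?_⟩
  intro φs φ hφ T hT us u hus hu t ht
  exact tendsto_iff_norm_sub_tendsto_zero.1 (DelayPDE.IsMildSolution.tendsto_segment hA hF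
    (tendsto_iff_norm_sub_tendsto_zero.2 hφ) hus hu ht)
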